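/- **Setting.** Let $E$ be a finite ground set with $n$ elements. A function $f:2^E\to\mathbb R_{\ge 0}$ is submodular if $f(S\cup\{e\})-f(S)\ge f(T\cup\{e\})-f(T)$ for all $S\subseteq T\subseteq E$, $e\in E\setminus T$, and symmetric if $f(S)=f(E\setminus S)$ for all $S\subseteq E$. Write $f(e|S)=f(S\cup\{e\})-f(S)$. The goal is to maximize $f(X)$ over $X\subseteq E$ with $|X|\le k$. **Streaming model.** The elements of $E$ arrive one by one, in uniformly random order. The memory of an algorithm consists of slots, each of which holds one element as a physical token, and of a string of bits. When an element arrives, the algorithm may query $f$ on any sets consisting of stored elements and the arriving one, and decides, on the basis of its bits and of these values only, which of these elements to keep (and in which order) and what the new bits are. At the end it returns a set of stored elements. The numbers $n,k,\varepsilon$ are known in advance. **Algorithm SymmetricStream**$(f,E,k,\varepsilon)$. Let $m=\lfloor \varepsilon n/(3k)\rfloor$, and let $w_1,\dots,w_{3k}$ be the first $3k$ consecutive blocks of $m$ elements of the stream. Put $S_0=\emptyset$ and, for $i=1,\dots,3k$, let $e_i$ be the first maximizer of $f(e|S_{i-1})$ over $e\in w_i$ and $S_i=S_{i-1}\cup\{e_i\}$.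 Then start with $H=\emptyset$ and scan the rest of the stream in order, adding $e$ to $H$ if at that moment $|H|<18k^2\log k/\varepsilon$ and $f(e|S_{i-1})>f(e_i|S_{i-1})$ for some $i\in\{1,\dots,3k\}$. Return a set $X\subseteq S_{3k}\cup H$ with $|X|\le k$ that maximizes $f$ among all such sets. (If $m=0$, so that the windows are empty, all $S_i$ are empty and every element passes the test $f(e|S_{i-1})>f(e_i|S_{i-1})$.) **Theorem.** For all $n$, $k\ge 1$ and $\varepsilon\in(0,1]$ there is an algorithm $A_{n,k,\varepsilon}$ in the streaming model that carries out SymmetricStream$(f,E,k,\varepsilon)$ for all ground sets $E$ of size $n$, all $f:2^E\to\mathbb R$ and all orders of arrival, such that the following hold. 1. There is an absolute constant $C$ such that for all $n$, $k\ge2$, $\varepsilon\in(0,1]$, and at all times, $A_{n,k,\varepsilon}$ stores at most $C k^2\log k/\varepsilon$ elements (counting the arriving one), which is $\widetilde O(k^2)$ for fixed $\varepsilon$; and it stores at most $\lceil\log_2(n+1)\rceil$ bits, which are enough for a counter of the position in the stream. 2. There are $\varepsilon_0>0$ and $k_0$ such that for all $k\ge k_0$, $0<\varepsilon\le\varepsilon_0$,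 all finite $E$ (of any size $n$) and all non-negative symmetric submodular $f$ on $E$, the expected value of the set $X$ returned by $A_{n,k,\varepsilon}$ on a uniformly random order of $E$ satisfies $$\mathbf E[f(X)]\ \ge\ 0.5029\cdot\max_{O\subseteq E,\ |O|\le k} f(O).$$ 3. For every $\delta>0$ there are $\varepsilon_0>0$ and $k_0$ such that for all $k\ge k_0$, $0<\varepsilon\le\varepsilon_0$, all finite $E$ and all non-negative submodular $f$ on $E$ (not necessarily symmetric or monotone), $\mathbf E[f(X)]\ge(1/2-\delta)\max_{O\subseteq E,\ |O|\le k}f(O)$. -/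

import Mathlib

universe u

/-! ### Submodular and symmetric set functions -/

/-- `f(S ∪ {e}) - f(S) ≥ f(T ∪ {e}) - f(T)` whenever `S ⊆ T` and `e ∉ T`. -/
def IsSubmodular {E : Type*} [DecidableEq E] (f : Finset E → ℝ) : Prop :=
  ∀ S T : Finset E, S ⊆ T → ∀ e : E, e ∉ T →
    f (insert e T) - f T ≤ f (insert e S) - f S

/-- A set and its complement have the same value. -/
def IsSymmetric {E : Type*} [Fintype E] [DecidableEq E] (f : Finset E → ℝ) : Prop :=
  ∀ S : Finset E, f S = f Sᶜ

/-! ### The streaming model -/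

/-- A (deterministic) one-pass streaming algorithm. Its memory consists of slots, each holding one
element of the ground set as a physical token, and of a string of bits.

* `step`: when an element arrives while `s` elements are stored, the slots are numbered
  `0, …, s - 1` and the arriving element has number `s`. The algorithm sees its bits and the values
  of all sets of available elements (named by their numbers), and nothing else. It returns the
  list of the numbers of the elements that it keeps, in their new order, and its new bits.
* `output`: at the end of the stream it returns a set of stored elements, seeing its bits and the
  values of all sets of stored elements. -/
structure StreamingAlgorithm where
  init : List Bool
  step : (s : ℕ) → List Bool → (Finset (Fin (s + 1)) → ℝ) → List (Fin (s + 1)) × List Bool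
  step_nodup : ∀ s bits query, (step s bits query).1.Nodup
  output : (s : ℕ) → List Bool → (Finset (Fin s) → ℝ) → Finset (Fin s)

/-- The content of the memory: the stored elements and the stored bits. -/
structure StreamMemory (E : Type*) where
  slots : List E
  bits : List Bool

namespace StreamingAlgorithm

variable {E : Type*} [DecidableEq E]

/-- The memory after the arrival of the element `e`; the value oracle of `f` is consulted only on
sets of elements that are stored or just arriving. -/
def next (A : StreamingAlgorithm) (f : Finset E → ℝ) (M : StreamMemory E) (e : E) :
    StreamMemory E :=
  let token : Fin (M.slots.length + 1) → E := fun j => (M.slots ++ [e]).get (j.cast (by simp))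
  let r := A.step M.slots.length M.bits (fun X => f (X.image token))
  ⟨r.1.map token, r.2⟩

/-- The memory after the elements of the list `L` have arrived in this order. -/
def memory (A : StreamingAlgorithm) (f : Finset E → ℝ) (L : List E) : StreamMemory E :=
  L.foldl (A.next f) ⟨[], A.init⟩

/-- The set that is returned after the stream `L`. -/
def result (A : StreamingAlgorithm) (f : Finset E → ℝ) (L : List E) : Finset E :=
  let M := A.memory f L
  (A.output M.slots.length M.bits (fun X => f (X.image M.slots.get))).image M.slots.get

end StreamingAlgorithm

/-! ### The algorithm SymmetricStream -/

namespace SymmetricStream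

variable {E : Type*} [DecidableEq E]

/-- The marginal gain `f(e | S)`. -/
def marginal (f : Finset E → ℝ) (e : E) (S : Finset E) : ℝ := f (insert e S) - f S

/-- The common size of the `3k` windows that make up the first `ε` fraction of a stream of `n`
elements (rounded down). -/
noncomputable def windowSize (n k : ℕ) (ε : ℝ) : ℕ := ⌊ε * n / (3 * k)⌋₊

/-- The windows of size `m` at the beginning of the stream `L`, numbered from `0`. -/
def window (m : ℕ) (L : List E) (i : ℕ) : List E := (L.drop (i * m)).take m

/-- The greedy sets `S_0 = ∅` and `S_{i+1} = S_i ∪ {e_{i+1}}`, where `e_{i+1}` is the element with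
the largest `f(e | S_i)` in window number `i`, the earliest one in case of a tie (nothing is added
if the window is empty). -/
noncomputable def greedySet (f : Finset E → ℝ) (m : ℕ) (L : List E) : ℕ → Finset E
  | 0 => ∅
  | i + 1 => greedySet f m L i ∪
      ((window m L i).argmax (fun e => marginal f e (greedySet f m L i))).toFinset

/-- The element `e_{i+1}` that is picked from window number `i`, if the window is not empty. -/
noncomputable def pick (f : Finset E → ℝ) (m : ℕ) (L : List E) (i : ℕ) : Option E :=
  (window m L i).argmax (fun e => marginal f e (greedySet f m L i))

/-- `f(e | S_i) > f(e_{i+1} | S_i)`; an empty window is beaten by every element. -/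
def Beats (f : Finset E → ℝ) (m : ℕ) (L : List E) (e : E) (i : ℕ) : Prop :=
  ∀ b ∈ pick f m L i, marginal f b (greedySet f m L i) < marginal f e (greedySet f m L i)

open Classical in
/-- The final set `H`: the elements behind the windows are scanned in the order of the stream, and
an element is added if it beats some window and `|H| < 18 k² log k / ε` at that moment. -/
noncomputable def heavySet (f : Finset E → ℝ) (k : ℕ) (ε : ℝ) (L : List E) : Finset E :=
  let m := windowSize L.length k ε
  (L.drop (3 * k * m)).foldl
    (fun H e =>
      if (H.card : ℝ) < 18 * (k : ℝ) ^ 2 * Real.log k / ε ∧ ∃ i < 3 * k, Beats f m L e i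
      then insert e H else H)
    ∅

/-- The set `S_{3k} ∪ H`. -/
noncomputable def pool (f : Finset E → ℝ) (k : ℕ) (ε : ℝ) (L : List E) : Finset E :=
  greedySet f (windowSize L.length k ε) L (3 * k) ∪ heavySet f k ε L

/-- `X` is a set that SymmetricStream returns on the stream `L`: it maximizes `f` among the subsets
of `S_{3k} ∪ H` with at most `k` elements. -/
def IsOutput (f : Finset E → ℝ) (k : ℕ) (ε : ℝ) (L : List E) (X : Finset E) : Prop :=
  X ⊆ pool f k ε L ∧ X.card ≤ k ∧ ∀ Y ⊆ pool f k ε L, Y.card ≤ k → f Y ≤ f X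

end SymmetricStream

/-- The expected value of the set that `A` returns when the ground set `E` arrives in uniformly
random order. -/
noncomputable def StreamingAlgorithm.expectedValue {E : Type*} [Fintype E] [DecidableEq E]
    (A : StreamingAlgorithm) (f : Finset E → ℝ) : ℝ :=
  Finset.expect Finset.univ
    (fun σ : Fin (Fintype.card E) ≃ E => f (A.result f (List.ofFn σ)))

/-!
Fix an order of arrival. Let `W` be the set of the elements in the windows, `O` an optimal set,
`O' = O \ W`, and let `S_j` be the greedy sets.

*Pointwise part.* Suppose that the bound on `|H|` is never active. Then the elements of
`O_L = O' \ H` beat no window, so with `ℓ = |O_L|` and `O_H = O' ∩ H` submodularity gives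
`ℓ (f(S_{j+1}) - f(S_j)) ≥ f(S_j ∪ O') - f(S_j ∪ O_H)` for all `j < 3k`
(`GreedyAgainst.step_le`). Let `V` be the value of the output and `q` the minimum of
`f(S_j ∪ O')` over `j ≤ 3k`. The sets `S_j ∪ O_H`, `j ≤ ℓ`, and `S_ℓ` are candidates for the output,
so summing over `j < ℓ` yields `V ≥ q - V` (`GreedyAgainst.half_le`). For symmetric `f` there are
two inequalities that contain `F = f(O_H)` with opposite signs. First, three consecutive pieces of
`ℓ` greedy elements can be added to `O_H` with a gain of at most `V - F` each, while
`f(S_{3ℓ}) ≤ f(S_{3ℓ} ∪ O_H) + F` by symmetry; hence `9 V ≥ 3 q + 4 F`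
(`GreedyAgainst.three_pieces`). Second, `f(S_j ∪ O_H) ≤ F + f(S_j) - f(∅)` makes the first greedy
steps large if `F` is small (`GreedyAgainst.le_greedy_of_recurrence`). Together they give
`V ≥ 0.504 q` (`GreedyAgainst.le_of_isSymmetric`).

*Probabilistic part.* Each element lies in `W` with probability at most `ε`. Uncrossing
(`IsSubmodular.sum_levels_le`) shows that a random set that contains each element with probability
at most `ε` has expected value at least `(1 - ε) f(∅)`, whatever the dependencies. Since the greedy
sets are subsets of `W`, this gives `E[q] ≥ (1 - 2 ε) f(O)`, although the minimizing `j` depends on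
the order (`le_sum_sdiff_union`). The bound on `|H|` is active with probability at most `6 / k`: if
many elements beat a window, then this window, a uniformly random part of the remaining stream,
avoids the elements with the largest marginal gains, and the probability of this is bounded by
swapping positions (`card_avoid_le`, `card_overflow_le`).

*Implementation.* The bits are a binary counter of the position in the stream. The meaning of each
slot is determined by the position: the picks of the finished windows come first, then the best
element so far of the current window or, later, the elements of `H`.
-/

/-! ### Submodular functions and uncrossing -/

section Submodular

variable {E : Type*} [DecidableEq E] {f : Finset E → ℝ}

/-- Marginal gains of a whole set decrease. -/
theorem IsSubmodular.union_sub_le (hf : IsSubmodular f) {S T D : Finset E} (hST : S ⊆ T)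
    (hD : Disjoint D T) : f (T ∪ D) - f T ≤ f (S ∪ D) - f S := by
  induction D using Finset.induction_on with
  | empty => simp
  | insert a D ha ih =>
    rw [Finset.disjoint_insert_left] at hD
    have h1 := ih hD.2
    have h2 := hf (S ∪ D) (T ∪ D) (Finset.union_subset_union_left hST) a (by simp [ha, hD.1])
    rw [Finset.union_insert, Finset.union_insert]
    linarith

theorem IsSubmodular.union_add_inter_le (hf : IsSubmodular f) (A B : Finset E) :
    f (A ∪ B) + f (A ∩ B) ≤ f A + f B := by
  have h := hf.union_sub_le (S := A ∩ B) (T := B) (D := A \ B) Finset.inter_subset_right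
    Finset.sdiff_disjoint
  have h1 : B ∪ A \ B = A ∪ B := by ext x; simp; tauto
  have h2 : A ∩ B ∪ A \ B = A := by ext x; simp; tauto
  rw [h1, h2] at h
  linarith

/-- The gain of a set is at most the sum of the gains of its elements. -/
theorem IsSubmodular.union_sub_le_sum (hf : IsSubmodular f) {S D : Finset E}
    (hD : Disjoint D S) : f (S ∪ D) - f S ≤ ∑ o ∈ D, (f (insert o S) - f S) := by
  induction D using Finset.induction_on with
  | empty => simp
  | insert a D ha ih =>
    rw [Finset.disjoint_insert_left] at hD
    have h1 := ih hD.2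
    have h2 := hf S (S ∪ D) Finset.subset_union_left a (by simp [ha, hD.1])
    rw [Finset.union_insert, Finset.sum_insert ha]
    linarith

theorem IsSubmodular.comp_union_left (hf : IsSubmodular f) (A : Finset E) :
    IsSubmodular fun Y => f (A ∪ Y) := by
  intro S T hST e he
  simp only [Finset.union_insert]
  by_cases heA : e ∈ A
  · simp [heA]
  · exact hf _ _ (Finset.union_subset_union_right hST) e (by simp [heA, he])

theorem IsSubmodular.comp_sdiff_left (hf : IsSubmodular f) (A : Finset E) :
    IsSubmodular fun Y => f (A \ Y) := by
  intro S T hST e he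
  by_cases heA : e ∈ A
  · have h := hf (A \ insert e T) (A \ insert e S)
      (Finset.sdiff_subset_sdiff le_rfl (Finset.insert_subset_insert e hST)) e (by simp)
    have h1 : insert e (A \ insert e T) = A \ T := by
      ext x; by_cases hx : x = e <;> simp [hx, heA, he]
    have h2 : insert e (A \ insert e S) = A \ S := by
      have heS : e ∉ S := fun h => he (hST h)
      ext x; by_cases hx : x = e <;> simp [hx, heA, heS]
    rw [h1, h2] at h
    dsimp only
    linarith
  · have h (Y : Finset E) : A \ insert e Y = A \ Y := by
      ext x; by_cases hx : x = e <;> simp [hx, heA]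
    simp [h]

/-- Symmetric submodular functions lose at most `f B` when a disjoint set `B` is added. -/
theorem IsSubmodular.le_union_add_of_isSymmetric [Fintype E] (hf : IsSubmodular f)
    (h0 : ∀ S, 0 ≤ f S) (hs : IsSymmetric f) {A B : Finset E} (h : Disjoint A B) :
    f A ≤ f (A ∪ B) + f B := by
  have h1 := hf.union_add_inter_le (A ∪ B) Bᶜ
  have h2 : (A ∪ B) ∩ Bᶜ = A := by
    ext x
    have : x ∈ A → x ∉ B := fun hx => Finset.disjoint_left.1 h hx
    simp; tauto
  rw [h2, ← hs B] at h1
  linarith [h0 (A ∪ B ∪ Bᶜ)]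

/-- Uncrossing: the sets `R ω` are replaced by the chain of the sets of all elements that are
covered at least `s + 1` times, and the sum of the values does not increase. -/
theorem IsSubmodular.sum_levels_le [Fintype E] (hf : IsSubmodular f) {Ω : Type*} [DecidableEq Ω]
    (R : Ω → Finset E) (P : Finset Ω) :
    ∑ s ∈ Finset.range P.card, f {e | s < (P.filter fun ω => e ∈ R ω).card} ≤
      ∑ ω ∈ P, f (R ω) := by
  induction P using Finset.induction_on with
  | empty => simp
  | insert a P ha ih =>
    rw [Finset.sum_insert ha, Finset.card_insert_of_notMem ha]
    set c : E → ℕ := fun e => (P.filter fun ω => e ∈ R ω).card with hc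
    have hc' (e : E) : ((insert a P).filter fun ω => e ∈ R ω).card
        = c e + if e ∈ R a then 1 else 0 := by
      rw [Finset.filter_insert]
      split_ifs with h
      · rw [Finset.card_insert_of_notMem (by simp [ha])]
      · rfl
    simp only [hc']
    -- `R a` is uncrossed with the sets of the old chain one after the other, the largest first
    have key (N : ℕ) :
        ∑ s ∈ Finset.range N, f {e | s < c e + if e ∈ R a then 1 else 0}
          + f {e | e ∈ R a ∧ N ≤ c e} ≤ f (R a) + ∑ s ∈ Finset.range N, f {e | s < c e} := by
      induction N with
      | zero => simp
      | succ N ihN =>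
        rw [Finset.sum_range_succ, Finset.sum_range_succ]
        have h := hf.union_add_inter_le ({e | e ∈ R a ∧ N ≤ c e} : Finset E)
          ({e | N < c e} : Finset E)
        have h1 : ({e | e ∈ R a ∧ N ≤ c e} : Finset E) ∪ ({e | N < c e} : Finset E)
            = ({e | N < c e + if e ∈ R a then 1 else 0} : Finset E) := by
          ext e
          by_cases he : e ∈ R a <;> simp [he]
          omega
        have h2 : ({e | e ∈ R a ∧ N ≤ c e} : Finset E) ∩ ({e | N < c e} : Finset E)
            = ({e | e ∈ R a ∧ N + 1 ≤ c e} : Finset E) := by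
          ext e
          simp
          omega
        rw [h1, h2] at h
        linarith
    rw [Finset.sum_range_succ]
    have hlast : ({e | P.card < c e + if e ∈ R a then 1 else 0} : Finset E)
        = ({e | e ∈ R a ∧ P.card ≤ c e} : Finset E) := by
      ext e
      have : c e ≤ P.card := Finset.card_filter_le _ _
      by_cases he : e ∈ R a <;> simp [he, this]
    rw [hlast]
    linarith [key P.card]

/-- If no element lies in more than a fraction `p` of the sets `R ω`, then the average of
`f (R ω)` is at least `(1 - p) f ∅`. -/
theorem IsSubmodular.le_sum_of_coverage [Fintype E] (hf : IsSubmodular f) (h0 : ∀ S, 0 ≤ f S)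
    {Ω : Type*} [Fintype Ω] [DecidableEq Ω] (R : Ω → Finset E) {p : ℝ} (hp0 : 0 ≤ p)
    (hp : ∀ e, ((Finset.univ.filter fun ω => e ∈ R ω).card : ℝ) ≤ p * Fintype.card Ω) :
    (1 - p) * Fintype.card Ω * f ∅ ≤ ∑ ω, f (R ω) := by
  refine le_trans ?_ (hf.sum_levels_le R Finset.univ)
  set c : E → ℕ := fun e => (Finset.univ.filter fun ω => e ∈ R ω).card with hc
  rw [Finset.card_univ]
  set N := Fintype.card Ω
  have hpN : 0 ≤ p * N := by positivity
  have h1 (s : ℕ) (hs : ⌊p * N⌋₊ ≤ s) : f {e | s < c e} = f ∅ := by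
    congr 1
    rw [Finset.filter_eq_empty_iff]
    intro e _
    rw [not_lt]
    exact (Nat.le_floor (hp e)).trans hs
  rcases le_total N ⌊p * N⌋₊ with hN | hN
  · have : (N : ℝ) ≤ p * N := (Nat.le_floor_iff hpN).1 hN
    calc (1 - p) * N * f ∅ ≤ 0 := mul_nonpos_of_nonpos_of_nonneg (by linarith) (h0 _)
      _ ≤ _ := Finset.sum_nonneg fun _ _ => h0 _
  · rw [← Finset.sum_range_add_sum_Ico _ hN, Finset.sum_congr rfl fun s hs =>
      h1 s (Finset.mem_Ico.1 hs).1]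
    have h2 : 0 ≤ ∑ s ∈ Finset.range ⌊p * N⌋₊, f {e | s < c e} :=
      Finset.sum_nonneg fun _ _ => h0 _
    have h3 : (⌊p * N⌋₊ : ℝ) ≤ p * N := Nat.floor_le hpN
    rw [Finset.sum_const, Nat.card_Ico, nsmul_eq_mul, Nat.cast_sub hN]
    nlinarith [h0 ∅]

end Submodular

/-! ### Chains that are greedy against a set -/

section GreedyChain

variable {E : Type*} [DecidableEq E] {f : Finset E → ℝ}

/-- A chain of sets `S 0 = ∅, …, S K` is *greedy against* the disjoint sets `OH` and `OL` if it
avoids them and if, up to step `K`, no element of `OL` has a larger marginal gain than the step of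
the chain. -/
structure GreedyAgainst (f : Finset E → ℝ) (S : ℕ → Finset E) (K : ℕ) (OH OL : Finset E) :
    Prop where
  zero : S 0 = ∅
  mono : Monotone S
  disjoint : Disjoint OL OH
  disjoint_chain : ∀ j ≤ K, Disjoint (S j) (OH ∪ OL)
  low : ∀ j < K, ∀ o ∈ OL, f (insert o (S j)) - f (S j) ≤ f (S (j + 1)) - f (S j)

namespace GreedyAgainst

variable {S : ℕ → Finset E} {K : ℕ} {OH OL : Finset E}

/-- A greedy step gains at least the average over `OL` of the gain of `OL` on top of `S j ∪ OH`. -/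
theorem step_le (h : GreedyAgainst f S K OH OL) (hf : IsSubmodular f) {j : ℕ} (hj : j < K) :
    f (S j ∪ (OH ∪ OL)) - f (S j ∪ OH) ≤ OL.card * (f (S (j + 1)) - f (S j)) := by
  have hd := Finset.disjoint_union_right.1 (h.disjoint_chain j hj.le)
  have h1 := hf.union_sub_le (S := S j) (T := S j ∪ OH) (D := OL) Finset.subset_union_left
    (Finset.disjoint_union_right.2 ⟨hd.2.symm, h.disjoint⟩)
  have h2 := hf.union_sub_le_sum (S := S j) (D := OL) hd.2.symm
  have h3 := Finset.sum_le_card_nsmul _ _ _ (h.low j hj)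
  rw [Finset.union_assoc] at h1
  rw [nsmul_eq_mul] at h3
  linarith

/-- Summing `step_le` over the steps from `a` to `b`. -/
theorem sum_step_le (h : GreedyAgainst f S K OH OL) (hf : IsSubmodular f) {q B : ℝ} {a b : ℕ}
    (hab : a ≤ b) (hb : b ≤ K) (hq : ∀ j ≤ K, q ≤ f (S j ∪ (OH ∪ OL)))
    (hB : ∀ j, a ≤ j → j < b → f (S j ∪ OH) ≤ B) :
    (b - a) * (q - B) ≤ OL.card * (f (S b) - f (S a)) := by
  induction b, hab using Nat.le_induction with
  | base => simp
  | succ b hab ih =>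
    have h1 := ih (by omega) fun j h1 h2 => hB j h1 (by omega)
    have h2 := h.step_le hf (j := b) (by omega)
    have h3 := hB b hab (by omega)
    have h4 := hq b (by omega)
    push_cast
    linarith

/-- The sets `S j ∪ OH` have value at most `V`, so each of the first `|OL|` steps gains at least
`(q - V) / |OL|`. -/
theorem half_le (h : GreedyAgainst f S K OH OL) (hf : IsSubmodular f) (h0 : ∀ S, 0 ≤ f S)
    {q V : ℝ} (hK : OL.card ≤ K) (hq : ∀ j ≤ K, q ≤ f (S j ∪ (OH ∪ OL)))
    (hV : ∀ j ≤ OL.card, f (S j ∪ OH) ≤ V) (hS : f (S OL.card) ≤ V) : q ≤ 2 * V := by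
  rcases Nat.eq_zero_or_pos OL.card with hl | hl
  · have h1 := hq 0 (Nat.zero_le _)
    have h2 := hV 0 (Nat.zero_le _)
    rw [Finset.card_eq_zero] at hl
    rw [hl, Finset.union_empty] at h1
    linarith [h0 (S 0 ∪ OH)]
  · have h1 := h.sum_step_le hf (Nat.zero_le _) hK hq fun j _ hj => hV j hj.le
    have hl' : (0 : ℝ) < OL.card := by exact_mod_cast hl
    rw [Nat.cast_zero, sub_zero, mul_le_mul_iff_right₀ hl'] at h1
    linarith [h0 (S 0)]

/-- Bounding `f (S j ∪ OH)` by `f (S j) + f OH - f ∅` turns `step_le` into a linear recurrence for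
the greedy values. -/
theorem le_greedy_of_recurrence (h : GreedyAgainst f S K OH OL) (hf : IsSubmodular f)
    {q : ℝ} (hl : 0 < OL.card) (hq : ∀ j ≤ K, q ≤ f (S j ∪ (OH ∪ OL))) {t : ℕ} (ht : t ≤ K) :
    (1 - (1 - 1 / (OL.card : ℝ)) ^ t) * (q - f OH) ≤ f (S t) - f ∅ := by
  have hl' : (1 : ℝ) ≤ OL.card := by exact_mod_cast hl
  set x : ℝ := 1 / (OL.card : ℝ) with hx
  have hx0 : 0 ≤ 1 - x := by
    rw [hx, sub_nonneg, div_le_one (by linarith)]; exact hl'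
  induction t with
  | zero => simp [h.zero]
  | succ t ih =>
    have h1 := ih (by omega)
    have h2 := h.step_le hf (j := t) (by omega)
    have h3 := hq t (by omega)
    have h4 := hf.union_add_inter_le (S t) OH
    have hd := Finset.disjoint_union_right.1 (h.disjoint_chain t (by omega))
    rw [Finset.disjoint_iff_inter_eq_empty.1 hd.1] at h4
    have h5 : x * (q - f OH - (f (S t) - f ∅)) ≤ f (S (t + 1)) - f (S t) := by
      rw [hx, one_div, inv_mul_le_iff₀ (by linarith)]
      linarith
    have h6 := mul_le_mul_of_nonneg_left h1 hx0
    rw [pow_succ]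
    linarith

/-- Three consecutive pieces of the chain, each of the size of `OL`, cannot all have a large value
together if `f` is symmetric, because the chain without `OH` loses at most `f OH`. -/
theorem three_pieces (h : GreedyAgainst f S K OH OL) [Fintype E] (hf : IsSubmodular f)
    (h0 : ∀ S, 0 ≤ f S) (hs : IsSymmetric f) {q V : ℝ} (hl : 0 < OL.card) (hK : 3 * OL.card ≤ K)
    (hq : ∀ j ≤ K, q ≤ f (S j ∪ (OH ∪ OL)))
    (hV : ∀ a b, a ≤ b → b ≤ K → b ≤ a + OL.card → f ((S b \ S a) ∪ OH) ≤ V) :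
    3 * q + 4 * f OH ≤ 9 * V := by
  set l := OL.card with hl_def
  -- the pieces are added to `OH` one after the other
  have hstep (a b : ℕ) (hab : a ≤ b) (hb : b ≤ K) (hbl : b ≤ a + l) :
      f (S b ∪ OH) ≤ f (S a ∪ OH) + V - f OH := by
    have h1 := hf.union_add_inter_le (S a ∪ OH) ((S b \ S a) ∪ OH)
    have h2 : S a ∪ OH ∪ (S b \ S a ∪ OH) = S b ∪ OH := by
      ext x
      have : x ∈ S a → x ∈ S b := fun hx => h.mono hab hx
      simp; tauto
    have h3 : (S a ∪ OH) ∩ (S b \ S a ∪ OH) = OH := by ext x; simp; tauto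
    rw [h2, h3] at h1
    linarith [hV a b hab hb hbl]
  have hz : f (S 0 ∪ OH) = f OH := by rw [h.zero, Finset.empty_union]
  have b1 (j : ℕ) (hj : j ≤ l) : f (S j ∪ OH) ≤ V := by
    linarith [hstep 0 j (by omega) (by omega) (by omega)]
  have b2 (j : ℕ) (hj : l ≤ j) (hj' : j ≤ 2 * l) : f (S j ∪ OH) ≤ 2 * V - f OH := by
    linarith [hstep l j (by omega) (by omega) (by omega), b1 l le_rfl]
  have b3 (j : ℕ) (hj : 2 * l ≤ j) (hj' : j ≤ 3 * l) : f (S j ∪ OH) ≤ 3 * V - 2 * f OH := by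
    linarith [hstep (2 * l) j (by omega) (by omega) (by omega), b2 (2 * l) (by omega) le_rfl]
  have s1 := h.sum_step_le hf (a := 0) (b := l) (by omega) (by omega) hq
    fun j _ hj => b1 j (by omega)
  have s2 := h.sum_step_le hf (a := l) (b := 2 * l) (by omega) (by omega) hq
    fun j h1 hj => b2 j h1 (by omega)
  have s3 := h.sum_step_le hf (a := 2 * l) (b := 3 * l) (by omega) (by omega) hq
    fun j h1 hj => b3 j h1 (by omega)
  have hl' : (0 : ℝ) < l := by exact_mod_cast hl
  have hsum : (l : ℝ) * (3 * q - 6 * V + 3 * f OH) ≤ l * (f (S (3 * l)) - f (S 0)) := by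
    rw [← hl_def] at s1 s2 s3
    push_cast at s1 s2 s3
    linarith
  rw [mul_le_mul_iff_right₀ hl'] at hsum
  have hd := Finset.disjoint_union_right.1 (h.disjoint_chain (3 * l) hK)
  have := hf.le_union_add_of_isSymmetric h0 hs hd.1
  linarith [b3 (3 * l) (by omega) le_rfl, h0 (S 0)]

end GreedyAgainst

/-- The second Bonferroni inequality. -/
theorem one_sub_pow_le {x : ℝ} (hx0 : 0 ≤ x) (hx1 : x ≤ 1) (t : ℕ) :
    (1 - x) ^ (t + 1) ≤ 1 - (t + 1) * x + (t + 1) * t / 2 * x ^ 2 := by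
  induction t with
  | zero => simp
  | succ t ih =>
    rw [pow_succ]
    have h := mul_le_mul_of_nonneg_right ih (sub_nonneg.2 hx1)
    have : (0 : ℝ) ≤ (t + 1) * t / 2 * x ^ 3 := by positivity
    push_cast
    nlinarith

/-- `three_pieces` bounds `V` well if `f OH` is large, the recurrence bounds it well if `f OH` is
small; a linear combination of both does not contain `f OH` any more. -/
theorem GreedyAgainst.le_of_isSymmetric {S : ℕ → Finset E} {K : ℕ} {OH OL : Finset E}
    (h : GreedyAgainst f S K OH OL) [Fintype E] (hf : IsSubmodular f)
    (h0 : ∀ S, 0 ≤ f S) (hs : IsSymmetric f) {q V : ℝ} (hq0 : 0 ≤ q) (hK : 3 * OL.card ≤ K)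
    (hq : ∀ j ≤ K, q ≤ f (S j ∪ (OH ∪ OL)))
    (hV : ∀ a b, a ≤ b → b ≤ K → b ≤ a + OL.card → f ((S b \ S a) ∪ OH) ≤ V)
    (hS : f (S OL.card) ≤ V) : 0.504 * q ≤ V := by
  have hV' (j : ℕ) (hj : j ≤ OL.card) : f (S j ∪ OH) ≤ V := by
    have := hV 0 j (by omega) (by omega) (by omega)
    rwa [h.zero, Finset.sdiff_empty] at this
  have hFV : f OH ≤ V := by
    have := hV' 0 (Nat.zero_le _)
    rwa [h.zero, Finset.empty_union] at this
  rcases le_or_gt q (f OH) with hqF | hqF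
  · linarith
  rcases Nat.eq_zero_or_pos OL.card with hl | hl
  · have h1 := hq 0 (Nat.zero_le _)
    rw [Finset.card_eq_zero] at hl
    rw [hl, Finset.union_empty, h.zero, Finset.empty_union] at h1
    linarith
  have h3 := h.three_pieces hf h0 hs hl hK hq hV
  set l := OL.card with hl_def
  have hl1 : (1 : ℝ) ≤ l := by exact_mod_cast hl
  -- the recurrence is used for about an eighth of the first `l` steps
  set s := l / 8 with hs_def
  have hsl : s + 1 ≤ l := by omega
  have h1 := h.le_greedy_of_recurrence hf hl hq (t := s + 1) (by omega)
  have h2 := h.sum_step_le hf (a := s + 1) (b := l) hsl (by omega) hq fun j _ hj => hV' j hj.le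
  rw [← hl_def] at h1 h2
  set x : ℝ := 1 / (l : ℝ) with hx
  have hxl : x * l = 1 := by rw [hx]; field_simp
  have hx0 : 0 < x := by positivity
  have hx1 : x ≤ 1 := by rw [hx, div_le_one (by linarith)]; exact hl1
  have hpow := one_sub_pow_le hx0.le hx1 s
  -- `y` is the fraction of the steps before the last one for which the recurrence is used
  set y : ℝ := s * x with hy
  have hy8 : y ≤ 1 / 8 := by
    have : (s : ℝ) * 8 ≤ l := by exact_mod_cast (by omega : s * 8 ≤ l)
    nlinarith
  have hτ : 1 / 8 ≤ y + x := by
    have : (l : ℝ) ≤ (s + 1) * 8 := by exact_mod_cast (by omega : l ≤ (s + 1) * 8)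
    nlinarith
  set τ : ℝ := y + x with hτ_def
  have hy0 : 0 ≤ y := by positivity
  have ha : τ * (1 - y / 2) ≤ 1 - (1 - x) ^ (s + 1) := by
    have : ((s : ℝ) + 1) * s / 2 * x ^ 2 = τ * y / 2 := by rw [hτ_def, hy]; ring
    have : ((s : ℝ) + 1) * x = τ := by rw [hτ_def, hy]; ring
    linarith
  have h1' : τ * (15 / 16) * (q - f OH) ≤ f (S (s + 1)) - f ∅ := by
    refine le_trans (mul_le_mul_of_nonneg_right ?_ (sub_nonneg.2 hqF.le)) h1
    refine le_trans ?_ ha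
    exact mul_le_mul_of_nonneg_left (by linarith) (by linarith)
  have h2' : (1 - τ) * (q - V) ≤ f (S l) - f (S (s + 1)) := by
    have := mul_le_mul_of_nonneg_left h2 hx0.le
    rw [← mul_assoc, ← mul_assoc, hxl, one_mul] at this
    refine le_trans (le_of_eq ?_) this
    rw [hτ_def, hy]
    push_cast
    linear_combination (q - V) * (-hxl)
  -- eliminate `f OH`
  have h4 : (1 - τ + τ * (15 / 16) * (7 / 4)) * q ≤ (2 - τ + τ * (15 / 16) * (9 / 4)) * V := by
    have := mul_le_mul_of_nonneg_left h3 (by linarith : 0 ≤ τ * (15 / 16) / 4)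
    linarith [h0 ∅]
  have hτ' : 0 ≤ (τ - 1 / 8) * q := mul_nonneg (by linarith) hq0
  have h5 : (2 - τ + τ * (15 / 16) * (9 / 4)) * (0.504 * q)
      ≤ (2 - τ + τ * (15 / 16) * (9 / 4)) * V := by
    refine le_trans ?_ h4
    nlinarith
  exact le_of_mul_le_mul_left h5 (by linarith)

end GreedyChain

/-! ### Random orders of arrival -/

theorem exists_top_subset {E : Type*} [DecidableEq E] (v : E → ℝ) (U : Finset E) (r : ℕ) (hr : r ≤ U.card) :
    ∃ T ⊆ U, T.card = r ∧ ∀ t ∈ T, ∀ x ∈ U, x ∉ T → v x ≤ v t := by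
  induction r with
  | zero => exact ⟨∅, by simp⟩
  | succ r ih =>
    obtain ⟨T, hTU, hc, hT⟩ := ih (by omega)
    have hne : (U \ T).Nonempty := by
      rw [← Finset.card_pos, Finset.card_sdiff_of_subset hTU]; omega
    obtain ⟨a, ha, hmax⟩ := Finset.exists_max_image (U \ T) v hne
    rw [Finset.mem_sdiff] at ha
    refine ⟨insert a T, Finset.insert_subset ha.1 hTU, by simp [ha.2, hc], ?_⟩
    intro t ht x hx hxT
    rw [Finset.mem_insert, not_or] at hxT
    rcases Finset.mem_insert.1 ht with rfl | ht
    · exact hmax x (Finset.mem_sdiff.2 ⟨hx, hxT.2⟩)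
    · exact hT t ht x hx hxT.2

section RandomOrder

variable {E : Type*} [DecidableEq E] [Fintype E] {n : ℕ}

open Finset

/-- If the properties `P` and `Q e` of an order of arrival survive the swap of the positions `p`
and `q`, then the elements at these positions are equally likely to satisfy `Q` given `P`. -/
theorem card_filter_swap (P : (Fin n ≃ E) → Prop) [DecidablePred P] (Q : E → (Fin n ≃ E) → Prop)
    [∀ e, DecidablePred (Q e)] (p q : Fin n)
    (hP : ∀ σ, P σ → P ((Equiv.swap p q).trans σ))
    (hQ : ∀ σ e, Q e σ → Q e ((Equiv.swap p q).trans σ)) :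
    #{σ | P σ ∧ Q (σ p) σ} = #{σ | P σ ∧ Q (σ q) σ} := by
  have hswap (σ : Fin n ≃ E) : (Equiv.swap p q).trans ((Equiv.swap p q).trans σ) = σ := by
    ext x; simp
  refine Finset.card_bij' (fun σ _ => (Equiv.swap p q).trans σ)
    (fun σ _ => (Equiv.swap p q).trans σ) ?_ ?_ (fun σ _ => hswap σ) (fun σ _ => hswap σ)
  · intro σ hσ
    simp only [mem_filter, mem_univ, true_and] at hσ ⊢
    exact ⟨hP σ hσ.1, by simpa using hQ σ _ hσ.2⟩
  · intro σ hσ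
    simp only [mem_filter, mem_univ, true_and] at hσ ⊢
    exact ⟨hP σ hσ.1, by simpa using hQ σ _ hσ.2⟩

/-- A given element arrives at a given position with probability `1 / n`. -/
theorem card_apply_eq (e : E) (p : Fin n) :
    n * #{σ : Fin n ≃ E | σ p = e} = Fintype.card (Fin n ≃ E) := by
  have h1 : ∀ q : Fin n, #{σ : Fin n ≃ E | σ q = e} = #{σ : Fin n ≃ E | σ p = e} := fun q => by
    have := card_filter_swap (fun _ => True) (fun x (_ : Fin n ≃ E) => x = e) q p
      (fun _ _ => trivial) (fun _ _ h => h)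
    simpa using this
  have h2 : ∑ q : Fin n, #{σ : Fin n ≃ E | σ q = e} = Fintype.card (Fin n ≃ E) := by
    simp_rw [Finset.card_filter]
    rw [Finset.sum_comm, ← Finset.card_univ, Finset.card_eq_sum_ones]
    refine Finset.sum_congr rfl fun σ _ => ?_
    rw [← Finset.card_filter, Finset.card_eq_one]
    refine ⟨σ.symm e, ?_⟩
    ext q
    simp [Equiv.eq_symm_apply]
  rw [← h2, Finset.sum_congr rfl fun q _ => h1 q]
  simp

/-- The set `T σ` of `r` elements is determined by the first `a` elements of the stream and avoids
them. The probability that the next `j` elements avoid it as well is at most `(1 - r / n) ^ j`. -/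
theorem card_avoid_le (T : (Fin n ≃ E) → Finset E) (a r : ℕ)
    (hinv : ∀ σ (p q : Fin n), a ≤ p → a ≤ q → T ((Equiv.swap p q).trans σ) = T σ)
    (hcard : ∀ σ, (T σ).card = r) (hT : ∀ σ, ∀ p : Fin n, p < a → σ p ∉ T σ) (j : ℕ)
    (hj : a + j ≤ n) :
    (#{σ : Fin n ≃ E | ∀ p : Fin n, a ≤ p → p < a + j → σ p ∉ T σ} : ℝ) ≤
      (1 - r / n) ^ j * Fintype.card (Fin n ≃ E) := by
  rcases isEmpty_or_nonempty (Fin n ≃ E) with hem | ⟨⟨σ₀⟩⟩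
  · simp
  have hrn : (r : ℝ) ≤ n := by
    have := Finset.card_le_univ (T σ₀)
    rw [hcard, ← Fintype.card_congr σ₀, Fintype.card_fin] at this
    exact_mod_cast this
  induction j with
  | zero => simp [Finset.card_le_univ]
  | succ j ih =>
    have ih := ih (by omega)
    set B : (Fin n ≃ E) → Prop := fun σ => ∀ p : Fin n, a ≤ p → p < a + j → σ p ∉ T σ with hB
    let p₀ : Fin n := ⟨a + j, by omega⟩
    have hn : (0 : ℝ) < n := by exact_mod_cast (by omega : 0 < n)
    have hswapB (q : Fin n) (hq : a + j ≤ q) (σ : Fin n ≃ E) (h : B σ) :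
        B ((Equiv.swap q p₀).trans σ) := by
      intro p hp1 hp2
      rw [hinv σ q p₀ (by omega) (by simp [p₀]), Equiv.trans_apply,
        Equiv.swap_apply_of_ne_of_ne]
      · exact h p hp1 hp2
      · intro h; rw [h] at hp2; omega
      · intro h; rw [h] at hp2; simp [p₀] at hp2
    have hle (q : Fin n) : #{σ : Fin n ≃ E | B σ ∧ σ q ∈ T σ}
        ≤ #{σ : Fin n ≃ E | B σ ∧ σ p₀ ∈ T σ} := by
      rcases lt_or_ge (q : ℕ) (a + j) with hq | hq
      · have : ({σ : Fin n ≃ E | B σ ∧ σ q ∈ T σ} : Finset _) = ∅ := by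
          rw [Finset.filter_eq_empty_iff]
          rintro σ - ⟨h1, h2⟩
          rcases lt_or_ge (q : ℕ) a with h3 | h3
          · exact hT σ q h3 h2
          · exact h1 q h3 hq h2
        rw [this]; simp
      · refine (card_filter_swap B (fun e σ => e ∈ T σ) q p₀ (hswapB q hq) ?_).le
        intro σ e he
        rwa [hinv σ q p₀ (by omega) (by simp [p₀])]
    have hsum : ∑ q : Fin n, #{σ : Fin n ≃ E | B σ ∧ σ q ∈ T σ} = #{σ | B σ} * r := by
      simp only [← Finset.filter_filter]
      simp_rw [Finset.card_filter _ (Finset.filter B _)]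
      rw [Finset.sum_comm, ← smul_eq_mul, ← Finset.sum_const]
      refine Finset.sum_congr rfl fun σ _ => ?_
      rw [← Finset.card_filter, ← hcard σ]
      refine Finset.card_bij (fun q _ => σ q) (by simp) (by simp) fun e he => ?_
      exact ⟨σ.symm e, by simpa using he, by simp⟩
    have hle' : #{σ | B σ} * r ≤ n * #{σ : Fin n ≃ E | B σ ∧ σ p₀ ∈ T σ} := by
      rw [← hsum]
      refine (Finset.sum_le_card_nsmul _ _ _ fun q _ => hle q).trans ?_
      simp
    have hsplit : #{σ : Fin n ≃ E | B σ ∧ σ p₀ ∈ T σ} + #{σ : Fin n ≃ E | B σ ∧ σ p₀ ∉ T σ}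
        = #{σ | B σ} := by
      rw [← Finset.filter_filter, ← Finset.filter_filter]
      exact Finset.card_filter_add_card_filter_not _
    have hnext : ({σ : Fin n ≃ E | ∀ p : Fin n, a ≤ p → p < a + (j + 1) → σ p ∉ T σ} : Finset _)
        = ({σ : Fin n ≃ E | B σ ∧ σ p₀ ∉ T σ} : Finset _) := by
      ext σ
      simp only [mem_filter, mem_univ, true_and]
      constructor
      · exact fun h => ⟨fun p h1 h2 => h p h1 (by omega), h p₀ (by simp [p₀]) (by simp [p₀])⟩
      · rintro ⟨h1, h2⟩ p h3 h4
        rcases Nat.lt_succ_iff_lt_or_eq.1 h4 with h5 | h5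
        · exact h1 p h3 h5
        · rwa [show p = p₀ from Fin.ext h5]
    rw [hnext]
    have hsplit' : (#{σ : Fin n ≃ E | B σ ∧ σ p₀ ∈ T σ} : ℝ)
        + #{σ : Fin n ≃ E | B σ ∧ σ p₀ ∉ T σ} = #{σ | B σ} := by exact_mod_cast hsplit
    have hle'' : (#{σ | B σ} : ℝ) * r ≤ n * #{σ : Fin n ≃ E | B σ ∧ σ p₀ ∈ T σ} := by
      exact_mod_cast hle'
    have h0 : 0 ≤ 1 - (r : ℝ) / n := by rw [sub_nonneg, div_le_one hn]; exact hrn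
    have h1 : (#{σ | B σ} : ℝ) * (r / n) ≤ #{σ : Fin n ≃ E | B σ ∧ σ p₀ ∈ T σ} := by
      rw [← mul_div_assoc, div_le_iff₀ hn]; linarith
    have h2 := mul_le_mul_of_nonneg_left ih h0
    rw [pow_succ]
    linarith

end RandomOrder

/-! ### Greedy sets along a stream and the elements that beat a window -/

namespace SymmetricStream

open Finset

section Stream

theorem window_eq_drop_take {E : Type*} (m : ℕ) (L : List E) (i : ℕ) :
    window m L i = (L.take ((i + 1) * m)).drop (i * m) := by
  rw [window, List.drop_take, Nat.succ_mul, Nat.add_sub_cancel_left]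

theorem apply_mem_take {E : Type*} {n : ℕ} {σ : Fin n ≃ E} {a : ℕ} {p : Fin n} :
    σ p ∈ (List.ofFn σ).take a ↔ (p : ℕ) < a := by
  rw [List.mem_take_iff_getElem]
  constructor
  · rintro ⟨i, hi, h⟩
    rw [List.getElem_ofFn] at h
    have := congrArg Fin.val (σ.injective h)
    simp at this hi
    omega
  · intro h
    refine ⟨p, by simpa using h, by simp⟩

theorem take_ofFn_swap {E : Type*} {n : ℕ} (σ : Fin n ≃ E) {a : ℕ} {p q : Fin n} (hp : a ≤ p)
    (hq : a ≤ q) :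
    (List.ofFn ((Equiv.swap p q).trans σ)).take a = (List.ofFn σ).take a := by
  refine List.ext_getElem (by simp) fun i h1 h2 => ?_
  have hi : i < a := by simp at h1; omega
  simp only [List.getElem_take, List.getElem_ofFn, Equiv.trans_apply]
  rw [Equiv.swap_apply_of_ne_of_ne]
  · intro h; rw [← h] at hp; exact absurd hp (not_le.2 hi)
  · intro h; rw [← h] at hq; exact absurd hq (not_le.2 hi)

variable {E : Type*} [DecidableEq E] {f : Finset E → ℝ} {m : ℕ} {L : List E}

theorem greedySet_congr {L' : List E} {i : ℕ} (h : L.take (i * m) = L'.take (i * m)) :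
    greedySet f m L i = greedySet f m L' i := by
  induction i with
  | zero => rfl
  | succ i ih =>
    have h1 : L.take (i * m) = L'.take (i * m) := by
      have hle : i * m ≤ (i + 1) * m := Nat.mul_le_mul_right _ (Nat.le_succ i)
      rw [← min_eq_left hle, ← List.take_take, ← List.take_take, h]
    have h2 : window m L i = window m L' i := by
      rw [window_eq_drop_take, window_eq_drop_take, h]
    rw [greedySet, greedySet, ih h1, h2]

theorem greedySet_succ_of_pick {i : ℕ} {b : E} (h : b ∈ pick f m L i) :
    greedySet f m L (i + 1) = insert b (greedySet f m L i) := by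
  rw [pick, Option.mem_def] at h
  rw [greedySet, h]
  ext
  simp

theorem greedySet_succ_of_pick_eq_none {i : ℕ} (h : pick f m L i = none) :
    greedySet f m L (i + 1) = greedySet f m L i := by
  rw [pick] at h
  rw [greedySet, h]
  simp

theorem greedySet_mono (f : Finset E → ℝ) (m : ℕ) (L : List E) : Monotone (greedySet f m L) :=
  monotone_nat_of_le_succ fun i => by
    rw [greedySet]; exact Finset.subset_union_left

theorem mem_take_of_mem_window {E : Type*} {m : ℕ} {L : List E} {i : ℕ} {e : E} (h : e ∈ window m L i) :
    e ∈ L.take ((i + 1) * m) := by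
  rw [window_eq_drop_take] at h
  exact List.mem_of_mem_drop h

theorem greedySet_subset_take (f : Finset E → ℝ) (m : ℕ) (L : List E) (i : ℕ) :
    greedySet f m L i ⊆ (L.take (i * m)).toFinset := by
  induction i with
  | zero => simp [greedySet]
  | succ i ih =>
    have hsub : (L.take (i * m)).toFinset ⊆ (L.take ((i + 1) * m)).toFinset := by
      intro x hx
      rw [List.mem_toFinset] at hx ⊢
      exact (List.take_sublist_take_left (Nat.mul_le_mul_right _ (Nat.le_succ i))).subset hx
    rcases h : pick f m L i with _ | b
    · rw [greedySet_succ_of_pick_eq_none h]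
      exact ih.trans hsub
    · rw [greedySet_succ_of_pick h]
      refine Finset.insert_subset ?_ (ih.trans hsub)
      rw [List.mem_toFinset]
      exact mem_take_of_mem_window (List.argmax_mem h)

/-- Every greedy step adds at most one element. -/
theorem card_greedySet_sdiff_le (f : Finset E → ℝ) (m : ℕ) (L : List E) {a b : ℕ} (hab : a ≤ b) :
    (greedySet f m L b \ greedySet f m L a).card ≤ b - a := by
  induction b, hab using Nat.le_induction with
  | base => simp
  | succ b hab ih =>
    have h : (greedySet f m L (b + 1) \ greedySet f m L a).card
        ≤ (greedySet f m L b \ greedySet f m L a).card + 1 := by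
      rcases h : pick f m L b with _ | x
      · rw [greedySet_succ_of_pick_eq_none h]; omega
      · rw [greedySet_succ_of_pick h]
        refine (Finset.card_le_card (t := insert x (greedySet f m L b \ greedySet f m L a))
          fun y hy => ?_).trans (Finset.card_insert_le _ _)
        simp only [mem_sdiff, mem_insert] at hy ⊢
        tauto
    omega

theorem exists_pick_of_not_beats {e : E} {i : ℕ} (h : ¬ Beats f m L e i) :
    ∃ b ∈ pick f m L i, marginal f e (greedySet f m L i) ≤ marginal f b (greedySet f m L i) := by
  simpa only [Beats, not_forall, not_lt, exists_prop] using h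

open Classical in
/-- The elements behind the first `K` windows that beat one of these windows. -/
noncomputable def beaters (f : Finset E → ℝ) (m K : ℕ) (L : List E) : Finset E :=
  (L.drop (K * m)).toFinset.filter fun e => ∃ i < K, Beats f m L e i

theorem mem_beaters {K : ℕ} {e : E} :
    e ∈ beaters f m K L ↔ e ∈ L.drop (K * m) ∧ ∃ i < K, Beats f m L e i := by
  classical
  rw [beaters, mem_filter, List.mem_toFinset]

/-- If there are few enough elements that beat a window, the bound on `|H|` is never active. -/
theorem heavySet_eq_beaters {k : ℕ} {ε : ℝ}
    (h : ((beaters f (windowSize L.length k ε) (3 * k) L).card : ℝ)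
      ≤ 18 * (k : ℝ) ^ 2 * Real.log k / ε) :
    heavySet f k ε L = beaters f (windowSize L.length k ε) (3 * k) L := by
  classical
  rw [heavySet]
  rw [beaters] at h ⊢
  set m := windowSize L.length k ε
  generalize L.drop (3 * k * m) = l at h
  induction l using List.reverseRecOn with
  | nil => simp
  | append_singleton l e ih =>
    have hset : (l ++ [e]).toFinset = insert e l.toFinset := by ext; simp
    rw [hset, Finset.filter_insert] at h ⊢
    have hle : ((l.toFinset.filter fun e => ∃ i < 3 * k, Beats f m L e i).card : ℝ)
        ≤ 18 * (k : ℝ) ^ 2 * Real.log k / ε := by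
      refine le_trans ?_ h
      split_ifs
      · exact_mod_cast Finset.card_le_card (Finset.subset_insert _ _)
      · exact le_rfl
    rw [List.foldl_append, ih hle, List.foldl_cons, List.foldl_nil]
    by_cases he : ∃ i < 3 * k, Beats f m L e i
    · rw [if_pos he] at h ⊢
      by_cases hmem : e ∈ l.toFinset.filter fun e => ∃ i < 3 * k, Beats f m L e i
      · rw [Finset.insert_eq_of_mem hmem, ite_self]
      · rw [Finset.card_insert_of_notMem hmem] at h
        push_cast at h
        rw [if_pos ⟨by linarith, he⟩]
    · rw [if_neg he, if_neg fun h => he h.2]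

end Stream

section RandomOrder

variable {E : Type*} [DecidableEq E] [Fintype E] {f : Finset E → ℝ} {n m K : ℕ}

open Classical in
/-- The probability that at least `r` elements beat window number `i`. In this case the window
avoids the `r` elements with the largest marginal gains among those that come after the first `i`
windows. -/
theorem card_many_beats_le (f : Finset E → ℝ) {i r : ℕ} (hi : i < K) (hKm : K * m ≤ n)
    (hrn : r ≤ n) :
    (#{σ : Fin n ≃ E | r ≤ #{e ∈ ((List.ofFn σ).drop (K * m)).toFinset |
      Beats f m (List.ofFn σ) e i}} : ℝ) ≤ (1 - r / n) ^ m * Fintype.card (Fin n ≃ E) := by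
  have him : (i + 1) * m ≤ K * m := Nat.mul_le_mul_right _ hi
  rw [Nat.succ_mul] at him
  set U : (Fin n ≃ E) → Finset E := fun σ => univ \ ((List.ofFn σ).take (i * m)).toFinset with hU
  have hUcard (σ : Fin n ≃ E) : #(U σ) = n - i * m := by
    rw [hU]
    dsimp only
    have hnd : ((List.ofFn σ).take (i * m)).Nodup :=
      (List.nodup_ofFn.2 σ.injective).sublist (List.take_sublist _ _)
    rw [Finset.card_sdiff_of_subset (Finset.subset_univ _), List.toFinset_card_of_nodup hnd,
      Finset.card_univ, ← Fintype.card_congr σ, Fintype.card_fin, List.length_take,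
      List.length_ofFn, min_eq_left (by omega)]
  have hsub (σ : Fin n ≃ E) : ((List.ofFn σ).drop (K * m)).toFinset ⊆ U σ := by
    intro e he
    rw [hU, mem_sdiff, List.mem_toFinset]
    refine ⟨mem_univ _, fun h => ?_⟩
    obtain ⟨p, rfl⟩ := σ.surjective e
    rw [apply_mem_take] at h
    rw [List.mem_toFinset, List.mem_drop_iff_getElem] at he
    obtain ⟨j, hj, he⟩ := he
    rw [List.getElem_ofFn] at he
    have := congrArg Fin.val (σ.injective he)
    simp at this
    omega
  rcases Nat.lt_or_ge (n - i * m) r with hr | hr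
  · rw [Finset.filter_eq_empty_iff.2]
    · simp only [card_empty, Nat.cast_zero]
      have : (r : ℝ) / n ≤ 1 := div_le_one_of_le₀ (by exact_mod_cast hrn) (Nat.cast_nonneg n)
      exact mul_nonneg (pow_nonneg (by linarith) _) (Nat.cast_nonneg _)
    · intro σ _ h
      have := h.trans ((Finset.card_filter_le _ _).trans (Finset.card_le_card (hsub σ)))
      rw [hUcard] at this
      omega
  · choose top htop_sub htop_card htop using fun (v : E → ℝ) (V : Finset E) (h : r ≤ #V) =>
      exists_top_subset v V r h
    set v : (Fin n ≃ E) → E → ℝ := fun σ e =>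
      marginal f e (greedySet f m (List.ofFn σ) i) with hv
    refine le_trans ?_ (card_avoid_le (fun σ => top (v σ) (U σ) (by rw [hUcard]; exact hr))
      (i * m) r ?_ (fun σ => htop_card _ _ _) ?_ m (by omega))
    · norm_cast
      refine Finset.card_le_card fun σ hσ => ?_
      simp only [mem_filter, mem_univ, true_and] at hσ ⊢
      intro p hp1 hp2 hpT
      have hw : σ p ∈ window m (List.ofFn σ) i := by
        rw [window, List.mem_take_iff_getElem]
        refine ⟨p - i * m, by simp; omega, ?_⟩
        simp only [List.getElem_drop, List.getElem_ofFn]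
        congr 1
        ext
        simp; omega
      obtain ⟨b, hb⟩ : ∃ b, b ∈ pick f m (List.ofFn σ) i := by
        rcases h : pick f m (List.ofFn σ) i with _ | b
        · rw [pick, List.argmax_eq_none] at h
          simp [h] at hw
        · exact ⟨b, rfl⟩
      have hpb : v σ (σ p) ≤ v σ b := List.le_of_mem_argmax hw hb
      -- all elements that beat the window lie in the top set, but `σ p` does not beat it
      have hss : ({e ∈ ((List.ofFn σ).drop (K * m)).toFinset | Beats f m (List.ofFn σ) e i}
          : Finset E) ⊂ top (v σ) (U σ) (by rw [hUcard]; exact hr) := by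
        rw [Finset.ssubset_iff_of_subset]
        · refine ⟨σ p, hpT, fun h => ?_⟩
          have := (Finset.mem_filter.1 h).2 b hb
          exact absurd hpb (not_le.2 this)
        · intro e he
          rw [Finset.mem_filter] at he
          by_contra heT
          have h1 := htop _ _ (by rw [hUcard]; exact hr) (σ p) hpT e (hsub σ he.1) heT
          exact absurd (h1.trans hpb) (not_le.2 (he.2 b hb))
      have := Finset.card_lt_card hss
      rw [htop_card] at this
      omega
    · intro σ p q hp hq
      have h1 : U ((Equiv.swap p q).trans σ) = U σ := by
        rw [hU]; dsimp only; rw [take_ofFn_swap σ hp hq]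
      have h2 : v ((Equiv.swap p q).trans σ) = v σ := by
        rw [hv]; dsimp only; rw [greedySet_congr (take_ofFn_swap σ hp hq)]
      simp only [h1, h2]
    · intro σ p hp h
      have := htop_sub _ _ _ h
      rw [hU, mem_sdiff, List.mem_toFinset, apply_mem_take] at this
      exact this.2 hp

end RandomOrder

end SymmetricStream

/-! ### The events of small probability -/

namespace SymmetricStream

open Finset

section RandomOrder

variable {E : Type*} [DecidableEq E] [Fintype E] {f : Finset E → ℝ} {n : ℕ}

theorem windows_le {k : ℕ} {ε : ℝ} (hk : 1 ≤ k) (hε : 0 < ε) :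
    ((3 * k * windowSize n k ε : ℕ) : ℝ) ≤ ε * n := by
  have h : (windowSize n k ε : ℝ) ≤ ε * n / (3 * k) := Nat.floor_le (by positivity)
  have hk' : (0 : ℝ) < 3 * k := by have : (0 : ℝ) < k := by exact_mod_cast hk
                                   linarith
  rw [le_div_iff₀ hk'] at h
  push_cast
  linarith

/-- With probability at least `1 - 6 / k` the bound on `|H|` is never active. -/
theorem card_overflow_le (f : Finset E → ℝ) {k : ℕ} {ε : ℝ} (hk : 2 ≤ k) (hε : 0 < ε)
    (hε1 : ε ≤ 1) :
    (#{σ : Fin n ≃ E | 18 * (k : ℝ) ^ 2 * Real.log k / ε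
        < #(beaters f (windowSize n k ε) (3 * k) (List.ofFn σ))} : ℝ)
      ≤ 6 / k * Fintype.card (Fin n ≃ E) := by
  classical
  have hk2 : (2 : ℝ) ≤ k := by exact_mod_cast hk
  have hlog : 1 / 2 ≤ Real.log k := by
    have := Real.log_le_log (by norm_num) hk2
    linarith [Real.log_two_gt_d9]
  set m := windowSize n k ε with hm
  have hKm : 3 * k * m ≤ n := by
    have h := windows_le (n := n) (by omega : 1 ≤ k) hε
    have : ((3 * k * m : ℕ) : ℝ) ≤ n := h.trans (mul_le_of_le_one_left (Nat.cast_nonneg n) hε1)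
    exact_mod_cast this
  rcases le_or_gt (n : ℝ) (18 * (k : ℝ) ^ 2 * Real.log k / ε) with hn | hn
  · -- there are too few elements for an overflow
    rw [Finset.filter_eq_empty_iff.2]
    · simp only [card_empty, Nat.cast_zero]; positivity
    · intro σ _
      rw [not_lt]
      refine le_trans ?_ hn
      have := Finset.card_le_univ (beaters f m (3 * k) (List.ofFn σ))
      rw [← Fintype.card_congr σ, Fintype.card_fin] at this
      exact_mod_cast this
  -- an overflow forces `r` elements to beat the same window
  set ρ : ℝ := 6 * k * Real.log k / ε with hρ
  have hρ0 : 0 ≤ ρ := by positivity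
  have hcap : 18 * (k : ℝ) ^ 2 * Real.log k / ε = 3 * k * ρ := by rw [hρ]; ring
  rw [hcap] at hn ⊢
  set r := ⌊ρ⌋₊ + 1 with hr
  have hrρ : ρ ≤ r := by rw [hr]; push_cast; exact (Nat.lt_floor_add_one ρ).le
  have hρ6 : 6 ≤ ρ := by
    rw [hρ, le_div_iff₀ hε]
    nlinarith
  have hrn : r ≤ n := by
    have h1 : (r : ℝ) ≤ ρ + 1 := by rw [hr]; push_cast; linarith [Nat.floor_le hρ0]
    have : (r : ℝ) ≤ n := by nlinarith
    exact_mod_cast this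
  have hn0 : (0 : ℝ) < n := by nlinarith
  have hsub : ({σ : Fin n ≃ E | 3 * k * ρ < #(beaters f m (3 * k) (List.ofFn σ))} : Finset _)
      ⊆ (range (3 * k)).biUnion fun i => {σ : Fin n ≃ E |
        r ≤ #{e ∈ ((List.ofFn σ).drop (3 * k * m)).toFinset | Beats f m (List.ofFn σ) e i}} := by
    intro σ hσ
    simp only [mem_filter, mem_univ, true_and, mem_biUnion, mem_range] at hσ ⊢
    by_contra! hcon
    refine absurd hσ (not_lt.2 ?_)
    have h1 : beaters f m (3 * k) (List.ofFn σ) ⊆ (range (3 * k)).biUnion fun i =>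
        {e ∈ ((List.ofFn σ).drop (3 * k * m)).toFinset | Beats f m (List.ofFn σ) e i} := by
      intro e he
      rw [mem_beaters] at he
      obtain ⟨i, hi, hb⟩ := he.2
      simp only [mem_biUnion, mem_filter, mem_range, List.mem_toFinset]
      exact ⟨i, hi, he.1, hb⟩
    have h2 : #(beaters f m (3 * k) (List.ofFn σ)) ≤ 3 * k * ⌊ρ⌋₊ := by
      refine (card_le_card h1).trans (card_biUnion_le.trans ?_)
      refine (sum_le_card_nsmul _ _ ⌊ρ⌋₊ fun i hi => ?_).trans (by simp)
      have := hcon i (mem_range.1 hi)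
      omega
    have h3 : (#(beaters f m (3 * k) (List.ofFn σ)) : ℝ) ≤ 3 * k * ⌊ρ⌋₊ := by exact_mod_cast h2
    exact h3.trans (mul_le_mul_of_nonneg_left (Nat.floor_le hρ0) (by positivity))
  -- for each window this has probability at most `2 / k ^ 2`
  have hprob : (1 - (r : ℝ) / n) ^ m ≤ 2 / (k : ℝ) ^ 2 := by
    have h0 : 0 ≤ 1 - (r : ℝ) / n := by
      rw [sub_nonneg, div_le_one hn0]; exact_mod_cast hrn
    have h1 : (1 - (r : ℝ) / n) ^ m ≤ Real.exp (-(m * (r / n))) := by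
      rw [← mul_neg, Real.exp_nat_mul]
      refine pow_le_pow_left₀ h0 ?_ _
      linarith [Real.add_one_le_exp (-((r : ℝ) / n))]
    have h2 : 2 * Real.log k - Real.log 2 ≤ m * (r / n) := by
      have hm1 : ε * n / (3 * k) - 1 ≤ m := (Nat.sub_one_lt_floor _).le
      have h3 : (ε * n / (3 * k) - 1) * (ρ / n) ≤ m * (r / n) := by
        refine mul_le_mul hm1 (by gcongr) (by positivity) (Nat.cast_nonneg m)
      -- rounding down the size of the windows matters little because `n > 3 k ρ`
      have h4 : (ε * n / (3 * k) - 1) * (ρ / n) = 2 * Real.log k - ρ / n := by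
        rw [hρ]; field_simp; ring
      have h5 : ρ / n ≤ 1 / 6 := by
        rw [div_le_iff₀ hn0]
        nlinarith
      linarith [Real.log_two_gt_d9]
    refine h1.trans ((Real.exp_le_exp.2 (neg_le_neg h2)).trans (le_of_eq ?_))
    rw [neg_sub, Real.exp_sub, Real.exp_log (by norm_num), two_mul, Real.exp_add,
      Real.exp_log (by linarith), pow_two]
  have hbound : (#((range (3 * k)).biUnion fun i => {σ : Fin n ≃ E |
      r ≤ #{e ∈ ((List.ofFn σ).drop (3 * k * m)).toFinset | Beats f m (List.ofFn σ) e i}}) : ℝ)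
      ≤ ∑ i ∈ range (3 * k), 2 / (k : ℝ) ^ 2 * Fintype.card (Fin n ≃ E) := by
    refine le_trans (Nat.cast_le.2 card_biUnion_le) ?_
    push_cast
    refine Finset.sum_le_sum fun i hi => ?_
    refine le_trans ?_ ((card_many_beats_le f (mem_range.1 hi) hKm hrn).trans
      (mul_le_mul_of_nonneg_right hprob (Nat.cast_nonneg _)))
    refine le_of_eq ?_
    congr!
  refine (Nat.cast_le.2 (card_le_card hsub)).trans (hbound.trans (le_of_eq ?_))
  rw [sum_const, card_range, nsmul_eq_mul]
  push_cast
  field_simp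
  ring

/-- Each element lies in the windows with probability at most `ε`. -/
theorem card_mem_windows_le {k : ℕ} {ε : ℝ} (hk : 1 ≤ k) (hε : 0 < ε) (e : E) :
    (#{σ : Fin n ≃ E | e ∈ ((List.ofFn σ).take (3 * k * windowSize n k ε)).toFinset} : ℝ)
      ≤ ε * Fintype.card (Fin n ≃ E) := by
  rcases isEmpty_or_nonempty (Fin n ≃ E) with hem | ⟨⟨σ₀⟩⟩
  · simp
  have hn : (0 : ℝ) < n := by
    have := (σ₀.symm e).pos
    exact_mod_cast this
  set a := 3 * k * windowSize n k ε with ha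
  have hsub : ({σ : Fin n ≃ E | e ∈ ((List.ofFn σ).take a).toFinset} : Finset _)
      ⊆ ({p : Fin n | (p : ℕ) < a} : Finset (Fin n)).biUnion fun p => {σ | σ p = e} := by
    intro σ hσ
    simp only [mem_filter, mem_univ, true_and, mem_biUnion, List.mem_toFinset] at hσ ⊢
    obtain ⟨p, rfl⟩ := σ.surjective e
    exact ⟨p, apply_mem_take.1 hσ, rfl⟩
  have hcard : #({p : Fin n | (p : ℕ) < a} : Finset (Fin n)) ≤ a := by
    rw [← card_map Fin.valEmbedding, ← card_range a]
    refine card_le_card fun x hx => ?_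
    simp only [mem_map, mem_filter, mem_univ, true_and] at hx
    obtain ⟨p, hp, rfl⟩ := hx
    simpa using hp
  have h1 : n * #{σ : Fin n ≃ E | e ∈ ((List.ofFn σ).take a).toFinset}
      ≤ a * Fintype.card (Fin n ≃ E) := by
    refine (Nat.mul_le_mul_left n ((card_le_card hsub).trans card_biUnion_le)).trans ?_
    rw [Finset.mul_sum, Finset.sum_congr rfl fun p _ => card_apply_eq e p, sum_const, smul_eq_mul]
    exact Nat.mul_le_mul_right _ hcard
  have h2 : (n : ℝ) * #{σ : Fin n ≃ E | e ∈ ((List.ofFn σ).take a).toFinset}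
      ≤ a * Fintype.card (Fin n ≃ E) := by exact_mod_cast h1
  have h3 : (a : ℝ) ≤ ε * n := windows_le hk hε
  have h4 := mul_le_mul_of_nonneg_right h3 (Nat.cast_nonneg (α := ℝ) (Fintype.card (Fin n ≃ E)))
  refine le_of_mul_le_mul_left ?_ hn
  linarith

/-- Removing the elements of the windows from a set `O` and adding any elements of the windows,
however they are chosen, costs in expectation only a small fraction of the value. -/
theorem le_sum_sdiff_union (hf : IsSubmodular f) (h0 : ∀ S, 0 ≤ f S) {k : ℕ} {ε : ℝ} (hk : 1 ≤ k)
    (hε : 0 < ε) (O : Finset E) (R : (Fin n ≃ E) → Finset E)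
    (hR : ∀ σ, R σ ⊆ ((List.ofFn σ).take (3 * k * windowSize n k ε)).toFinset) :
    (1 - 2 * ε) * Fintype.card (Fin n ≃ E) * f O ≤
      ∑ σ : Fin n ≃ E,
        f (R σ ∪ (O \ ((List.ofFn σ).take (3 * k * windowSize n k ε)).toFinset)) := by
  set W : (Fin n ≃ E) → Finset E := fun σ =>
    ((List.ofFn σ).take (3 * k * windowSize n k ε)).toFinset with hW
  have hcov (Q : (Fin n ≃ E) → Finset E) (hQ : ∀ σ, Q σ ⊆ W σ) (e : E) :
      (#{σ | e ∈ Q σ} : ℝ) ≤ ε * Fintype.card (Fin n ≃ E) := by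
    refine le_trans ?_ (card_mem_windows_le hk hε e)
    exact_mod_cast card_le_card (monotone_filter_right _ fun σ _ h => hQ σ h)
  have h1 := (hf.comp_union_left O).le_sum_of_coverage (fun _ => h0 _) R hε.le (hcov R hR)
  have h2 := (hf.comp_sdiff_left O).le_sum_of_coverage (fun _ => h0 _) (fun σ => W σ \ R σ) hε.le
    (hcov _ fun σ => sdiff_subset)
  have h3 : ∑ σ, (f (O ∪ R σ) + f (O \ (W σ \ R σ))) ≤ ∑ σ, (f (R σ ∪ (O \ W σ)) + f O) := by
    refine Finset.sum_le_sum fun σ _ => ?_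
    have h := hf.union_add_inter_le (R σ ∪ (O \ W σ)) O
    have e1 : R σ ∪ (O \ W σ) ∪ O = O ∪ R σ := by ext x; simp; tauto
    have e2 : (R σ ∪ (O \ W σ)) ∩ O = O \ (W σ \ R σ) := by
      ext x
      have : x ∈ R σ → x ∈ W σ := fun h => hR σ h
      simp; tauto
    rwa [e1, e2] at h
  rw [sum_add_distrib, sum_add_distrib, sum_const, card_univ, nsmul_eq_mul] at h3
  simp only [union_empty, sdiff_empty] at h1 h2
  linarith

end RandomOrder

end SymmetricStream

/-! ### The value of the output -/

namespace SymmetricStream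

open Finset

section Ratio

variable {E : Type*} [DecidableEq E] {f : Finset E → ℝ} {n k : ℕ} {ε : ℝ}

section Pointwise

variable {σ : Fin n ≃ E} {X O : Finset E}

/-- The part of `O` that arrives after the windows. -/
noncomputable def tailPart (k : ℕ) (ε : ℝ) (σ : Fin n ≃ E) (O : Finset E) : Finset E :=
  O \ ((List.ofFn σ).take (3 * k * windowSize n k ε)).toFinset

/-- If the bound on `|H|` is never active, the greedy sets form a chain that is greedy against the
elements of `O` that arrive late; those that are not in `H` beat no window. -/
theorem greedyAgainst_tailPart
    (hgood : (#(beaters f (windowSize n k ε) (3 * k) (List.ofFn σ)) : ℝ)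
      ≤ 18 * (k : ℝ) ^ 2 * Real.log k / ε) (O : Finset E) :
    GreedyAgainst f (greedySet f (windowSize n k ε) (List.ofFn σ)) (3 * k)
      (tailPart k ε σ O ∩ heavySet f k ε (List.ofFn σ))
      (tailPart k ε σ O \ heavySet f k ε (List.ofFn σ)) where
  zero := rfl
  mono := greedySet_mono _ _ _
  disjoint := by
    rw [Finset.disjoint_left]
    intro x hx hx'
    exact (mem_sdiff.1 hx).2 (mem_inter.1 hx').2
  disjoint_chain j hj := by
    rw [Finset.disjoint_left]
    intro x hx hx'
    have h1 := greedySet_subset_take _ _ _ _ (greedySet_mono _ _ _ hj hx)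
    have h2 : x ∈ tailPart k ε σ O := by
      rw [mem_union, mem_inter, mem_sdiff] at hx'
      tauto
    exact (mem_sdiff.1 h2).2 h1
  low j hj o ho := by
    have hH := heavySet_eq_beaters (f := f) (k := k) (ε := ε) (L := List.ofFn σ)
      (by rwa [List.length_ofFn])
    rw [List.length_ofFn] at hH
    rw [hH, mem_sdiff, tailPart, mem_sdiff, mem_beaters, List.mem_toFinset] at ho
    obtain ⟨⟨-, h1⟩, h2⟩ := ho
    have h3 : o ∈ (List.ofFn σ).drop (3 * k * windowSize n k ε) := by
      have : o ∈ List.ofFn σ := (List.mem_ofFn' _ _).2 (σ.surjective o)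
      rw [← List.take_append_drop (3 * k * windowSize n k ε) (List.ofFn σ),
        List.mem_append] at this
      tauto
    have h4 : ¬ Beats f (windowSize n k ε) (List.ofFn σ) o j := fun h => h2 ⟨h3, j, hj, h⟩
    obtain ⟨b, hb, hle⟩ := exists_pick_of_not_beats h4
    rw [greedySet_succ_of_pick hb]
    exact hle

/-- A piece of the chain together with `O_H` competes with the output if the piece has at most as
many steps as there are elements of `O_L`. -/
theorem IsOutput.le_of_piece (hX : IsOutput f k ε (List.ofFn σ) X) (hO : #O ≤ k)
    {a b : ℕ} (hab : a ≤ b) (hb : b ≤ 3 * k)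
    (hba : b ≤ a + #(tailPart k ε σ O \ heavySet f k ε (List.ofFn σ))) :
    f ((greedySet f (windowSize n k ε) (List.ofFn σ) b \
      greedySet f (windowSize n k ε) (List.ofFn σ) a) ∪
        (tailPart k ε σ O ∩ heavySet f k ε (List.ofFn σ))) ≤ f X := by
  refine hX.2.2 _ ?_ ?_
  · rw [pool, List.length_ofFn]
    exact union_subset_union (sdiff_subset.trans (greedySet_mono _ _ _ hb)) inter_subset_right
  · refine (card_union_le _ _).trans ?_
    have h1 := card_greedySet_sdiff_le f (windowSize n k ε) (List.ofFn σ) hab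
    have h2 := card_inter_add_card_sdiff (tailPart k ε σ O) (heavySet f k ε (List.ofFn σ))
    have h3 : #(tailPart k ε σ O) ≤ #O := card_le_card sdiff_subset
    omega

theorem card_tailPart_sdiff_le (hO : #O ≤ k) (H : Finset E) : #(tailPart k ε σ O \ H) ≤ k :=
  (card_le_card (sdiff_subset.trans sdiff_subset)).trans hO

theorem IsOutput.le_of_prefix (hX : IsOutput f k ε (List.ofFn σ) X) (hO : #O ≤ k) :
    f (greedySet f (windowSize n k ε) (List.ofFn σ)
      #(tailPart k ε σ O \ heavySet f k ε (List.ofFn σ))) ≤ f X := by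
  set l := #(tailPart k ε σ O \ heavySet f k ε (List.ofFn σ)) with hl
  have hlk : l ≤ k := card_tailPart_sdiff_le hO _
  refine hX.2.2 _ ?_ ?_
  · rw [pool, List.length_ofFn]
    exact (greedySet_mono _ _ _ (by omega)).trans subset_union_left
  · have h1 := card_greedySet_sdiff_le f (windowSize n k ε) (List.ofFn σ) (Nat.zero_le l)
    rw [greedySet, sdiff_empty] at h1
    omega

variable (hX : IsOutput f k ε (List.ofFn σ) X) (hO : #O ≤ k) (hf : IsSubmodular f)
  (h0 : ∀ S, 0 ≤ f S)
  (hgood : (#(beaters f (windowSize n k ε) (3 * k) (List.ofFn σ)) : ℝ)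
    ≤ 18 * (k : ℝ) ^ 2 * Real.log k / ε)

include hX hO hf h0 hgood

theorem half_le_output {q : ℝ}
    (hq : ∀ j ≤ 3 * k, q ≤ f (greedySet f (windowSize n k ε) (List.ofFn σ) j ∪ tailPart k ε σ O)) :
    1 / 2 * q ≤ f X := by
  have h := greedyAgainst_tailPart hgood O
  have hl : #(tailPart k ε σ O \ heavySet f k ε (List.ofFn σ)) ≤ k := card_tailPart_sdiff_le hO _
  have := h.half_le hf h0 (q := q) (V := f X) (by omega) ?_ ?_ (hX.le_of_prefix hO)
  · linarith
  · rwa [union_comm (_ ∩ _), sdiff_union_inter]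
  · intro j hj
    have := hX.le_of_piece hO (Nat.zero_le j) (by omega) (by omega)
    rwa [h.zero, sdiff_empty] at this

theorem le_output_of_isSymmetric [Fintype E] (hs : IsSymmetric f) {q : ℝ} (hq0 : 0 ≤ q)
    (hq : ∀ j ≤ 3 * k, q ≤ f (greedySet f (windowSize n k ε) (List.ofFn σ) j ∪ tailPart k ε σ O)) :
    0.504 * q ≤ f X := by
  have h := greedyAgainst_tailPart hgood O
  have hl : #(tailPart k ε σ O \ heavySet f k ε (List.ofFn σ)) ≤ k := card_tailPart_sdiff_le hO _
  refine h.le_of_isSymmetric hf h0 hs hq0 (by omega) ?_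
    (fun a b hab hb hba => hX.le_of_piece hO hab hb hba) (hX.le_of_prefix hO)
  rwa [union_comm (_ ∩ _), sdiff_union_inter]

end Pointwise

/-- From a bound that holds whenever `|H|` stays below its limit to a bound in expectation. -/
theorem le_sum_of_pointwise [Fintype E] (hf : IsSubmodular f) (h0 : ∀ S, 0 ≤ f S) (hk : 2 ≤ k) (hε : 0 < ε)
    (hε1 : ε ≤ 1) {c : ℝ} (hc : 0 ≤ c) {O : Finset E} (hO : #O ≤ k)
    (hopt : ∀ Y : Finset E, #Y ≤ k → f Y ≤ f O) (X : (Fin n ≃ E) → Finset E)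
    (hX : ∀ σ : Fin n ≃ E, (#(beaters f (windowSize n k ε) (3 * k) (List.ofFn σ)) : ℝ)
      ≤ 18 * (k : ℝ) ^ 2 * Real.log k / ε → ∀ q, 0 ≤ q → (∀ j ≤ 3 * k, q ≤
        f (greedySet f (windowSize n k ε) (List.ofFn σ) j ∪ tailPart k ε σ O)) → c * q ≤ f (X σ)) :
    c * (1 - 2 * ε - 6 / k) * f O * Fintype.card (Fin n ≃ E) ≤ ∑ σ, f (X σ) := by
  classical
  set S : (Fin n ≃ E) → ℕ → Finset E := fun σ => greedySet f (windowSize n k ε) (List.ofFn σ)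
    with hS
  set good : (Fin n ≃ E) → Prop := fun σ => (#(beaters f (windowSize n k ε) (3 * k)
    (List.ofFn σ)) : ℝ) ≤ 18 * (k : ℝ) ^ 2 * Real.log k / ε with hgood
  -- the step of the chain at which the union with the late part of `O` is worst
  have hmin (σ : Fin n ≃ E) : ∃ j ≤ 3 * k, ∀ i ≤ 3 * k,
      f (S σ j ∪ tailPart k ε σ O) ≤ f (S σ i ∪ tailPart k ε σ O) := by
    obtain ⟨j, hj, h⟩ := Finset.exists_min_image (range (3 * k + 1))
      (fun j => f (S σ j ∪ tailPart k ε σ O)) ⟨0, by simp⟩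
    refine ⟨j, by simpa [Nat.lt_succ_iff] using hj, fun i hi => h i ?_⟩
    simpa [Nat.lt_succ_iff] using hi
  choose j hj hjmin using hmin
  have h1 := le_sum_sdiff_union hf h0 (by omega : 1 ≤ k) hε O (fun σ => S σ (j σ))
    fun σ => (greedySet_mono _ _ _ (hj σ)).trans (greedySet_subset_take _ _ _ _)
  have h2 : ∑ σ, c * f (S σ (j σ) ∪ tailPart k ε σ O)
      ≤ ∑ σ, (f (X σ) + if good σ then 0 else c * f O) := by
    refine Finset.sum_le_sum fun σ _ => ?_
    split_ifs with hg
    · rw [add_zero]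
      exact hX σ hg _ (h0 _) (hjmin σ)
    · refine le_trans (mul_le_mul_of_nonneg_left ?_ hc) (le_add_of_nonneg_left (h0 _))
      have hz := hjmin σ 0 (Nat.zero_le _)
      rw [show S σ 0 = ∅ from rfl, empty_union] at hz
      exact hz.trans (hopt _ ((card_le_card sdiff_subset).trans hO))
  have h3 := card_overflow_le (n := n) f hk hε hε1
  have h4 : ∑ σ, (if good σ then 0 else c * f O) = c * f O * #{σ | ¬ good σ} := by
    rw [Finset.sum_ite, sum_const_zero, zero_add, sum_const, nsmul_eq_mul, mul_comm]
  have h5 : (#{σ | ¬ good σ} : ℝ) ≤ 6 / k * Fintype.card (Fin n ≃ E) := by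
    refine le_trans (le_of_eq ?_) h3
    congr! 3 with σ
    rw [hgood, not_le]
  rw [sum_add_distrib, h4, ← Finset.mul_sum] at h2
  have h6 := mul_le_mul_of_nonneg_left h5 (mul_nonneg hc (h0 O))
  have h7 := mul_le_mul_of_nonneg_left h1 hc
  unfold tailPart at h2
  linarith

end Ratio

end SymmetricStream

/-! ### The streaming algorithm -/

namespace SymmetricStream

section Algorithm

/-- The number with the given binary digits, the lowest one first; a left inverse of `Nat.bits`. -/
def natOfBits (l : List Bool) : ℕ := l.foldr Nat.bit 0

theorem natOfBits_bits (n : ℕ) : natOfBits n.bits = n := by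
  induction n using Nat.binaryRec' with
  | zero => simp [natOfBits]
  | bit b n h ih =>
    rw [Nat.bits_append_bit _ _ h, natOfBits, List.foldr_cons]
    exact congrArg _ ih

/-- The first `i` of the `s + 1` tokens at hand, which are the stored elements in their order and
then the arriving element. -/
def firstTokens (s i : ℕ) : Finset (Fin (s + 1)) := {j | (j : ℕ) < i}

open Classical in
/-- The decision of SymmetricStream at position `t` of the stream while `s` elements are stored, as
the number of the token that is dropped; nothing is dropped if it is `s + 1`. The stored elements
are the elements picked from the finished windows, then the best element so far of the current
window (if any) or the elements of `H`. Hence the first `i` tokens form the set `S_i`, and in the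
current window `i` the first `i + 1` tokens form `S_i` with the best element so far. -/
noncomputable def dropIndex (n k : ℕ) (ε : ℝ) (t s : ℕ) (q : Finset (Fin (s + 1)) → ℝ) : ℕ :=
  let m := windowSize n k ε
  if t < 3 * k * m then
    if t % m = 0 then s + 1
    else if q (firstTokens s (t / m + 1)) < q (insert (Fin.last s) (firstTokens s (t / m))) then
      t / m
    else s
  else if ((s - if m = 0 then 0 else 3 * k : ℕ) : ℝ) < 18 * (k : ℝ) ^ 2 * Real.log k / ε ∧
      (m = 0 ∨ ∃ i < 3 * k,
        q (firstTokens s (i + 1)) < q (insert (Fin.last s) (firstTokens s i))) then s + 1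
  else s

theorem exists_best_subset (k s : ℕ) (q : Finset (Fin s) → ℝ) :
    ∃ Y : Finset (Fin s), Y.card ≤ k ∧ ∀ Z : Finset (Fin s), Z.card ≤ k → q Z ≤ q Y := by
  obtain ⟨Y, hY, h⟩ := Finset.exists_max_image
    (Finset.univ.filter fun Y : Finset (Fin s) => Y.card ≤ k) q ⟨∅, by simp⟩
  exact ⟨Y, by simpa using hY, fun Z hZ => h Z (by simpa using hZ)⟩

/-- SymmetricStream as a streaming algorithm whose bits are a binary counter of the position. -/
noncomputable def algorithm (n k : ℕ) (ε : ℝ) : StreamingAlgorithm where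
  init := []
  step s bits q := ((List.finRange (s + 1)).eraseIdx (dropIndex n k ε (natOfBits bits) s q),
    (natOfBits bits + 1).bits)
  step_nodup s _ _ := (List.nodup_finRange (s + 1)).eraseIdx _
  output s _ q := (exists_best_subset k s q).choose

variable {E : Type*} [DecidableEq E]

/-- The query function that the algorithm sees when `e` arrives while the elements of `l` are
stored. -/
def query (f : Finset E → ℝ) (l : List E) (e : E) (X : Finset (Fin (l.length + 1))) : ℝ :=
  f (X.image fun j => (l ++ [e]).get (j.cast (by simp)))

theorem image_firstTokens (l : List E) (e : E) {i : ℕ} (hi : i ≤ l.length) :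
    (firstTokens l.length i).image (fun j => (l ++ [e]).get (j.cast (by simp)))
      = (l.take i).toFinset := by
  ext x
  simp only [firstTokens, Finset.mem_image, Finset.mem_filter, Finset.mem_univ, true_and,
    List.mem_toFinset, List.mem_take_iff_getElem, List.get_eq_getElem, Fin.val_cast]
  constructor
  · rintro ⟨j, hj, rfl⟩
    exact ⟨j, by omega, by rw [List.getElem_append_left (by omega)]⟩
  · rintro ⟨j, hj, rfl⟩
    exact ⟨⟨j, by omega⟩, by simp; omega, by
      simp only; rw [List.getElem_append_left (by omega)]⟩

theorem query_firstTokens (f : Finset E → ℝ) (l : List E) (e : E) {i : ℕ} (hi : i ≤ l.length) :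
    query f l e (firstTokens l.length i) = f (l.take i).toFinset := by
  rw [query, image_firstTokens l e hi]

theorem query_insert_firstTokens (f : Finset E → ℝ) (l : List E) (e : E) {i : ℕ}
    (hi : i ≤ l.length) :
    query f l e (insert (Fin.last _) (firstTokens l.length i))
      = f (insert e (l.take i).toFinset) := by
  rw [query, Finset.image_insert, image_firstTokens l e hi]
  simp

theorem algorithm_next (n k : ℕ) (ε : ℝ) (f : Finset E → ℝ) (l : List E) (t : ℕ) (e : E) :
    (algorithm n k ε).next f ⟨l, t.bits⟩ e =
      ⟨(l ++ [e]).eraseIdx (dropIndex n k ε t l.length (query f l e)), (t + 1).bits⟩ := by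
  have h : (List.finRange (l.length + 1)).map
      (fun j => (l ++ [e]).get (j.cast (by simp))) = l ++ [e] := by
    refine List.ext_getElem (by simp) fun i h1 h2 => by simp
  rw [StreamingAlgorithm.next]
  simp only [algorithm, natOfBits_bits]
  congr 1
  rw [← List.eraseIdx_map, h]
  rfl

theorem memory_append (A : StreamingAlgorithm) (f : Finset E → ℝ) (L : List E) (e : E) :
    A.memory f (L ++ [e]) = A.next f (A.memory f L) e := by
  simp [StreamingAlgorithm.memory]

/-- The elements picked from the first `i` windows. -/
noncomputable def picks (f : Finset E → ℝ) (m : ℕ) (L : List E) (i : ℕ) : List E :=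
  (List.range i).filterMap (pick f m L)

theorem picks_succ (f : Finset E → ℝ) (m : ℕ) (L : List E) (i : ℕ) :
    picks f m L (i + 1) = picks f m L i ++ (pick f m L i).toList := by
  rw [picks, List.range_succ, List.filterMap_append, ← picks]
  rcases h : pick f m L i with _ | b <;> simp [h]

theorem toFinset_picks (f : Finset E → ℝ) (m : ℕ) (L : List E) (i : ℕ) :
    (picks f m L i).toFinset = greedySet f m L i := by
  induction i with
  | zero => rfl
  | succ i ih =>
    rw [picks_succ, List.toFinset_append, ih]
    rcases h : pick f m L i with _ | b
    · rw [greedySet_succ_of_pick_eq_none h]; simp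
    · rw [greedySet_succ_of_pick h]; ext; simp

variable {f : Finset E → ℝ} {m K : ℕ} {L : List E}

theorem picks_eq_nil (i : ℕ) : picks f 0 L i = [] := by
  induction i with
  | zero => rfl
  | succ i ih => rw [picks_succ, ih]; simp [pick, window]

theorem exists_pick (hm : 0 < m) (hK : K * m ≤ L.length) {i : ℕ} (hi : i < K) :
    ∃ b, pick f m L i = some b := by
  rcases h : pick f m L i with _ | b
  · rw [pick, List.argmax_eq_none, window, List.take_eq_nil_iff, List.drop_eq_nil_iff] at h
    have : (i + 1) * m ≤ K * m := Nat.mul_le_mul_right _ hi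
    rw [Nat.succ_mul] at this
    omega
  · exact ⟨b, rfl⟩

theorem length_picks (hm : 0 < m) (hK : K * m ≤ L.length) {i : ℕ} (hi : i ≤ K) :
    (picks f m L i).length = i := by
  induction i with
  | zero => rfl
  | succ i ih =>
    obtain ⟨b, hb⟩ := exists_pick (f := f) hm hK hi
    rw [picks_succ, List.length_append, ih (by omega), hb]
    rfl

theorem length_picks_le (i : ℕ) : (picks f m L i).length ≤ i := by
  rw [picks]
  simpa using List.length_filterMap_le (pick f m L) (List.range i)

theorem take_picks (hm : 0 < m) (hK : K * m ≤ L.length) {i j : ℕ} (hij : i ≤ j) (hj : j ≤ K) :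
    (picks f m L j).take i = picks f m L i := by
  induction j, hij using Nat.le_induction with
  | base =>
    exact List.take_of_length_le (length_picks_le _)
  | succ j hij ih =>
    rw [picks_succ, List.take_append_of_le_length, ih (by omega)]
    rw [length_picks hm hK (by omega)]
    exact hij

/-- The stored elements after the first `t` elements of the stream, while the windows are read. -/
noncomputable def windowSlots (f : Finset E → ℝ) (m : ℕ) (L : List E) (t : ℕ) : List E :=
  picks f m L (t / m) ++ (((window m L (t / m)).take (t % m)).argmax
    fun e => marginal f e (greedySet f m L (t / m))).toList

theorem windowSlots_succ (n k : ℕ) (ε : ℝ) {t : ℕ} (hn : 3 * k * windowSize n k ε ≤ L.length)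
    (ht : t < 3 * k * windowSize n k ε) (htL : t < L.length) :
    (windowSlots f (windowSize n k ε) L t ++ [L[t]]).eraseIdx (dropIndex n k ε t
        (windowSlots f (windowSize n k ε) L t).length
        (query f (windowSlots f (windowSize n k ε) L t) L[t])) =
      windowSlots f (windowSize n k ε) L (t + 1) := by
  set m := windowSize n k ε with hm_def
  set e := L[t] with he
  have hm : 0 < m := Nat.pos_of_mul_pos_left (lt_of_le_of_lt (Nat.zero_le _) ht)
  set i := t / m with hi
  set r := t % m with hr
  have htm : i * m + r = t := Nat.div_add_mod' t m
  have hrm : r < m := Nat.mod_lt _ hm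
  have hiK : i < 3 * k := (Nat.div_lt_iff_lt_mul hm).2 ht
  set v : E → ℝ := fun e => marginal f e (greedySet f m L i) with hv
  have hlen : (picks f m L i).length = i := length_picks hm hn hiK.le
  have htake : (window m L i).take (r + 1) = (window m L i).take r ++ [e] := by
    have hr' : r < (window m L i).length := by
      rw [window, List.length_take, List.length_drop]; omega
    rw [List.take_succ_eq_append_getElem hr']
    congr 2
    simp only [window, List.getElem_take, List.getElem_drop, he, htm]
  -- at the end of a window the best element becomes the pick
  have hnext : windowSlots f m L (t + 1)
      = picks f m L i ++ (((window m L i).take (r + 1)).argmax v).toList := by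
    rcases Nat.lt_or_ge (r + 1) m with hlt | hge
    · have h1 : (t + 1) / m = i := by
        rw [← htm, add_assoc, Nat.add_comm, Nat.add_mul_div_right _ _ hm, Nat.div_eq_of_lt hlt,
          zero_add]
      have h2 : (t + 1) % m = r + 1 := by
        rw [← htm, add_assoc, Nat.add_comm, Nat.add_mul_mod_self_right, Nat.mod_eq_of_lt hlt]
      rw [windowSlots, h1, h2]
    · have h3 : t + 1 = (i + 1) * m := by rw [Nat.succ_mul]; omega
      have h1 : (t + 1) / m = i + 1 := by rw [h3, Nat.mul_div_cancel _ hm]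
      have h2 : (t + 1) % m = 0 := by rw [h3, Nat.mul_mod_left]
      have h4 : (window m L i).take (r + 1) = window m L i := by
        refine List.take_of_length_le ?_
        rw [window, List.length_take]; omega
      rw [windowSlots, h1, h2, h4, picks_succ]
      simp [pick, hv]
  rw [hnext, htake, List.argmax_concat]
  rw [dropIndex]
  simp only [← hm_def, if_pos ht, ← hi, ← hr]
  rcases Nat.eq_zero_or_pos r with hr0 | hr0
  · rw [if_pos hr0]
    rw [List.eraseIdx_of_length_le (by simp)]
    simp [windowSlots, ← hi, ← hr, hr0]
  · obtain ⟨c, hc⟩ : ∃ c, ((window m L i).take r).argmax v = some c := by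
      rcases h : ((window m L i).take r).argmax v with _ | c
      · have hr' : r ≤ (window m L i).length := by
          rw [window, List.length_take, List.length_drop]; omega
        rw [List.argmax_eq_none, List.take_eq_nil_iff] at h
        rcases h with h | h
        · omega
        · rw [h, List.length_nil] at hr'; omega
      · exact ⟨c, rfl⟩
    have hslots : windowSlots f m L t = picks f m L i ++ [c] := by
      rw [windowSlots, hc]; rfl
    have hlen' : (windowSlots f m L t).length = i + 1 := by rw [hslots]; simp [hlen]
    rw [if_neg (by omega), query_firstTokens _ _ _ (by omega),
      query_insert_firstTokens _ _ _ (by omega)]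
    have h1 : ((windowSlots f m L t).take (i + 1)).toFinset = insert c (greedySet f m L i) := by
      rw [List.take_of_length_le (by omega), hslots, List.toFinset_append, toFinset_picks]
      ext; simp
    have h2 : ((windowSlots f m L t).take i).toFinset = greedySet f m L i := by
      rw [hslots, List.take_append_of_le_length (by omega), List.take_of_length_le (by omega),
        toFinset_picks]
    have h3 : f (insert c (greedySet f m L i)) < f (insert e (greedySet f m L i)) ↔ v c < v e := by
      rw [hv]; simp only [marginal]; exact (sub_lt_sub_iff_right _).symm
    rw [h1, h2, hc]
    by_cases hce : v c < v e
    · rw [if_pos (h3.2 hce)]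
      simp only [if_pos hce]
      rw [hslots, List.append_assoc, List.eraseIdx_append_of_length_le (by omega), hlen]
      simp
    · rw [if_neg (mt h3.1 hce)]
      simp only [if_neg hce]
      rw [List.eraseIdx_append_of_length_le (by omega), hslots]
      simp

open Classical in
/-- The set `H` after a part `l` of the stream behind the windows; `L` is the whole stream. -/
noncomputable def heavyPrefix (f : Finset E → ℝ) (k : ℕ) (ε : ℝ) (m : ℕ) (L l : List E) :
    Finset E :=
  l.foldl (fun H e =>
      if (H.card : ℝ) < 18 * (k : ℝ) ^ 2 * Real.log k / ε ∧ ∃ i < 3 * k, Beats f m L e i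
      then insert e H else H) ∅

theorem beats_iff (hm : 0 < m) (hK : K * m ≤ L.length) {i : ℕ} (hi : i < K) (e : E) :
    Beats f m L e i ↔
      f (greedySet f m L (i + 1)) < f (insert e (greedySet f m L i)) := by
  obtain ⟨b, hb⟩ := exists_pick (f := f) hm hK hi
  rw [greedySet_succ_of_pick hb, Beats, hb]
  simp [marginal]

/-- After the windows and a further part `l` of the stream the memory holds the picked elements,
followed by the elements of the current set `H`. The bound on the length allows for the element
that is added when `|H|` is just below its limit. -/
structure IsTailSlots (f : Finset E → ℝ) (k : ℕ) (ε : ℝ) (m : ℕ) (L l : List E)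
    (slots H : List E) : Prop where
  eq_append : slots = picks f m L (3 * k) ++ H
  nodup : H.Nodup
  toFinset_eq : H.toFinset = heavyPrefix f k ε m L l
  subset : H ⊆ l
  length_le : (H.length : ℝ) ≤ max 0 (18 * (k : ℝ) ^ 2 * Real.log k / ε + 1)

theorem IsTailSlots.step {n k : ℕ} {ε : ℝ} {l slots H : List E} {t : ℕ} {e : E} (hk : 1 ≤ k)
    (hn : 3 * k * windowSize n k ε ≤ L.length)
    (h : IsTailSlots f k ε (windowSize n k ε) L l slots H)
    (ht : 3 * k * windowSize n k ε ≤ t) (he : e ∉ l) :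
    ∃ H', IsTailSlots f k ε (windowSize n k ε) L (l ++ [e])
      ((slots ++ [e]).eraseIdx (dropIndex n k ε t slots.length (query f slots e))) H' := by
  classical
  set m := windowSize n k ε with hm_def
  have hcount : slots.length - (if m = 0 then 0 else 3 * k) = (heavyPrefix f k ε m L l).card := by
    rw [← h.toFinset_eq, List.toFinset_card_of_nodup h.nodup, h.eq_append, List.length_append]
    split_ifs with hm
    · rw [hm, picks_eq_nil]; simp
    · rw [length_picks (Nat.pos_of_ne_zero hm) hn le_rfl]; omega
  have hbeats : (m = 0 ∨ ∃ i < 3 * k, query f slots e (firstTokens slots.length (i + 1))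
      < query f slots e (insert (Fin.last _) (firstTokens slots.length i)))
      ↔ ∃ i < 3 * k, Beats f m L e i := by
    rcases Nat.eq_zero_or_pos m with hm | hm
    · -- empty windows are beaten by every element
      simp only [hm, true_or, true_iff]
      exact ⟨0, by omega, by simp [Beats, pick, window]⟩
    · rw [or_iff_right (by omega)]
      refine exists_congr fun i => and_congr_right fun hi => ?_
      have hlen := length_picks (f := f) hm hn (le_refl (3 * k))
      have hsl : 3 * k ≤ slots.length := by rw [h.eq_append, List.length_append]; omega
      have htk (j : ℕ) (hj : j ≤ 3 * k) : (slots.take j).toFinset = greedySet f m L j := by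
        rw [h.eq_append, List.take_append_of_le_length (by omega), take_picks hm hn hj le_rfl,
          toFinset_picks]
      rw [query_firstTokens _ _ _ (by omega), query_insert_firstTokens _ _ _ (by omega),
        htk _ (by omega), htk _ (by omega), beats_iff hm hn hi]
  have heH : e ∉ H := fun hmem => he (h.subset hmem)
  have hprefix : heavyPrefix f k ε m L (l ++ [e]) =
      if ((heavyPrefix f k ε m L l).card : ℝ) < 18 * (k : ℝ) ^ 2 * Real.log k / ε ∧
        ∃ i < 3 * k, Beats f m L e i
      then insert e (heavyPrefix f k ε m L l) else heavyPrefix f k ε m L l := by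
    simp only [heavyPrefix, List.foldl_append, List.foldl_cons, List.foldl_nil]
    congr!
  rw [dropIndex]
  simp only [← hm_def, if_neg (not_lt.2 ht), hcount, hbeats]
  split_ifs at hprefix ⊢ with hc
  · refine ⟨H ++ [e], ?_, ?_, ?_, ?_, ?_⟩
    · rw [List.eraseIdx_of_length_le (by simp), h.eq_append, List.append_assoc]
    · rw [List.nodup_append]
      refine ⟨h.nodup, by simp, ?_⟩
      intro a ha b hb hab
      rw [List.mem_singleton] at hb
      exact heH (by rwa [← hb, ← hab])
    · rw [hprefix, List.toFinset_append, h.toFinset_eq]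
      ext; simp
    · exact List.append_subset.2 ⟨fun x hx => List.mem_append_left _ (h.subset hx), by simp⟩
    · refine le_max_of_le_right ?_
      rw [List.length_append, ← List.toFinset_card_of_nodup h.nodup, h.toFinset_eq]
      push_cast
      simp only [List.length_singleton, Nat.cast_one]
      linarith [hc.1]
  · refine ⟨H, ?_, h.nodup, ?_, ?_, h.length_le⟩
    · rw [List.eraseIdx_append_of_length_le le_rfl]
      simp [h.eq_append]
    · rw [hprefix, h.toFinset_eq]
    · exact fun x hx => List.mem_append_left _ (h.subset hx)

end Algorithm

end SymmetricStream

/-! ### Memory, output and approximation ratio -/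

namespace SymmetricStream

section Memory

variable {E : Type*} [DecidableEq E] {f : Finset E → ℝ} {k : ℕ} {ε : ℝ} {L : List E}

theorem memory_take_of_le (f : Finset E → ℝ)
    (hn : 3 * k * windowSize L.length k ε ≤ L.length) {t : ℕ}
    (ht : t ≤ 3 * k * windowSize L.length k ε) :
    (algorithm L.length k ε).memory f (L.take t) =
      ⟨windowSlots f (windowSize L.length k ε) L t, t.bits⟩ := by
  induction t with
  | zero => simp [StreamingAlgorithm.memory, algorithm, windowSlots, picks]
  | succ t ih =>
    have htL : t < L.length := by omega
    rw [List.take_succ_eq_append_getElem htL, memory_append, ih (by omega), algorithm_next,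
      windowSlots_succ _ _ _ hn (by omega) htL]

theorem isTailSlots_windowSlots (f : Finset E → ℝ) (k : ℕ) (ε : ℝ) (m : ℕ) (L : List E) :
    IsTailSlots f k ε m L [] (windowSlots f m L (3 * k * m)) [] where
  eq_append := by
    rw [windowSlots]
    rcases Nat.eq_zero_or_pos m with hm | hm
    · subst hm
      simp [picks_eq_nil]
    · simp [Nat.mul_div_cancel _ hm]
  nodup := List.nodup_nil
  toFinset_eq := rfl
  subset := List.nil_subset _
  length_le := by simp

theorem memory_take_of_ge (f : Finset E → ℝ) (hk : 1 ≤ k) (hL : L.Nodup)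
    (hn : 3 * k * windowSize L.length k ε ≤ L.length) {t : ℕ}
    (ht : 3 * k * windowSize L.length k ε ≤ t) (htL : t ≤ L.length) :
    ∃ slots H, (algorithm L.length k ε).memory f (L.take t) = ⟨slots, t.bits⟩ ∧
      IsTailSlots f k ε (windowSize L.length k ε) L
        ((L.take t).drop (3 * k * windowSize L.length k ε)) slots H := by
  induction t, ht using Nat.le_induction with
  | base =>
    refine ⟨_, [], memory_take_of_le f hn le_rfl, ?_⟩
    rw [List.drop_eq_nil_of_le (List.length_take_le _ _)]
    exact isTailSlots_windowSlots f k ε _ L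
  | succ t ht ih =>
    obtain ⟨slots, H, hmem, h⟩ := ih (by omega)
    have htL' : t < L.length := htL
    have hnot : L[t] ∉ (L.take t).drop (3 * k * windowSize L.length k ε) := by
      intro hmem
      have h1 := List.mem_of_mem_drop hmem
      rw [List.mem_take_iff_getElem] at h1
      obtain ⟨i, hi, hi'⟩ := h1
      have := (hL.getElem_inj_iff).1 hi'
      omega
    obtain ⟨H', h'⟩ := h.step hk hn ht hnot
    rw [List.take_succ_eq_append_getElem htL', memory_append, hmem, algorithm_next,
      List.drop_append_of_le_length (by simp; omega)]
    exact ⟨_, H', rfl, h'⟩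

theorem windows_le_length (hk : 1 ≤ k) (hε : 0 < ε) (hε1 : ε ≤ 1) (n : ℕ) :
    3 * k * windowSize n k ε ≤ n := by
  have h := (windows_le (n := n) hk hε).trans
    (mul_le_of_le_one_left (Nat.cast_nonneg n) hε1)
  exact_mod_cast h

/-- A set of elements of a list `l` can be named by no more positions than it has elements, even
if `l` has repetitions. -/
theorem exists_card_le_image_get {l : List E} {Y : Finset E} (hY : Y ⊆ l.toFinset) :
    ∃ Z : Finset (Fin l.length), Z.card ≤ Y.card ∧ Z.image l.get = Y := by
  have h : ∀ y : Y, ∃ j : Fin l.length, l.get j = y := fun y =>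
    List.mem_iff_get.1 (List.mem_toFinset.1 (hY y.2))
  choose j hj using h
  simp only [List.get_eq_getElem] at hj
  refine ⟨Y.attach.image j, Finset.card_image_le.trans (Finset.card_attach).le, ?_⟩
  rw [Finset.image_image]
  ext y
  simp [Function.comp_def, hj]

theorem isOutput_algorithm (f : Finset E → ℝ) (hk : 1 ≤ k) (hε : 0 < ε) (hε1 : ε ≤ 1)
    (hL : L.Nodup) : IsOutput f k ε L ((algorithm L.length k ε).result f L) := by
  classical
  have hn := windows_le_length hk hε hε1 L.length
  obtain ⟨slots, H, hmem, h⟩ := memory_take_of_ge f hk hL hn hn le_rfl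
  rw [List.take_length] at hmem h
  have hpool : slots.toFinset = pool f k ε L := by
    rw [h.eq_append, List.toFinset_append, toFinset_picks, h.toFinset_eq, pool]
    congr 1
  rw [StreamingAlgorithm.result, hmem]
  simp only [algorithm]
  have hspec := (exists_best_subset k slots.length
    fun X => f (X.image slots.get)).choose_spec
  refine ⟨?_, Finset.card_image_le.trans hspec.1, fun Y hY hYk => ?_⟩
  · rw [← hpool]
    intro x hx
    obtain ⟨j, -, rfl⟩ := Finset.mem_image.1 hx
    exact List.mem_toFinset.2 (List.get_mem _ _)
  · rw [← hpool] at hY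
    obtain ⟨Z, hZ, rfl⟩ := exists_card_le_image_get hY
    exact hspec.2 Z (hZ.trans hYk)

theorem isOutput_algorithm_ofFn (f : Finset E → ℝ) {n : ℕ} (hk : 1 ≤ k) (hε : 0 < ε)
    (hε1 : ε ≤ 1) (σ : Fin n ≃ E) :
    IsOutput f k ε (List.ofFn σ) ((algorithm n k ε).result f (List.ofFn σ)) := by
  have h := isOutput_algorithm f hk hε hε1 (List.nodup_ofFn.2 σ.injective)
  rwa [List.length_ofFn] at h

/-- There are at most `3 k` picked elements and `18 x + 1` elements of `H`, where
`x = k² log k / ε ≥ k`. -/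
theorem length_slots_le (f : Finset E → ℝ) (hk : 2 ≤ k) (hε : 0 < ε) (hε1 : ε ≤ 1)
    (hL : L.Nodup) {t : ℕ} (ht : t ≤ L.length) :
    (((algorithm L.length k ε).memory f (L.take t)).slots.length : ℝ) + 1
      ≤ 23 * ((k : ℝ) ^ 2 * Real.log k / ε) := by
  have hn := windows_le_length (by omega : 1 ≤ k) hε hε1 L.length
  have hk2 : (2 : ℝ) ≤ k := by exact_mod_cast hk
  set x := (k : ℝ) ^ 2 * Real.log k / ε with hx
  have hkx : (k : ℝ) ≤ x := by
    have hlog : 1 / 2 ≤ Real.log k := by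
      have := Real.log_le_log (by norm_num) hk2
      linarith [Real.log_two_gt_d9]
    rw [hx, le_div_iff₀ hε]
    have h1 : (k : ℝ) * ε ≤ k := mul_le_of_le_one_right (by linarith) hε1
    nlinarith
  have hpicks : ((picks f (windowSize L.length k ε) L (3 * k)).length : ℝ) ≤ 3 * k := by
    exact_mod_cast length_picks_le _
  rcases le_total t (3 * k * windowSize L.length k ε) with htm | htm
  · rw [memory_take_of_le f hn htm]
    have h1 : (windowSlots f (windowSize L.length k ε) L t).length ≤ 3 * k + 1 := by
      rw [windowSlots, List.length_append]
      have h2 : t / windowSize L.length k ε ≤ 3 * k := Nat.div_le_of_le_mul (by linarith)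
      have h3 := length_picks_le (f := f) (m := windowSize L.length k ε) (L := L)
        (t / windowSize L.length k ε)
      have h4 : ∀ o : Option E, o.toList.length ≤ 1 := fun o => by cases o <;> simp
      exact Nat.add_le_add (h3.trans h2) (h4 _)
    have h2 : ((windowSlots f (windowSize L.length k ε) L t).length : ℝ) ≤ 3 * k + 1 := by
      exact_mod_cast h1
    dsimp only
    linarith
  · obtain ⟨slots, H, hmem, h⟩ := memory_take_of_ge f (by omega) hL hn htm ht
    rw [hmem, h.eq_append]
    dsimp only
    rw [List.length_append]
    push_cast
    have h1 := h.length_le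
    have h2 : 18 * (k : ℝ) ^ 2 * Real.log k / ε = 18 * x := by rw [hx]; ring
    rw [h2, max_eq_right (by linarith)] at h1
    linarith

theorem length_bits_le (f : Finset E → ℝ) (hk : 1 ≤ k) (hε : 0 < ε) (hε1 : ε ≤ 1)
    (hL : L.Nodup) {t : ℕ} (ht : t ≤ L.length) :
    ((algorithm L.length k ε).memory f (L.take t)).bits.length ≤ Nat.size L.length := by
  have hn := windows_le_length hk hε hε1 L.length
  have h : ((algorithm L.length k ε).memory f (L.take t)).bits = t.bits := by
    rcases le_total t (3 * k * windowSize L.length k ε) with htm | htm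
    · rw [memory_take_of_le f hn htm]
    · obtain ⟨slots, H, hmem, -⟩ := memory_take_of_ge f hk hL hn htm ht
      rw [hmem]
  rw [h, Nat.size_eq_bits_len]
  exact Nat.size_le_size ht

end Memory

section Expectation

variable {E : Type*} [Fintype E] [DecidableEq E] {f : Finset E → ℝ} {k : ℕ} {ε : ℝ}

/-- The approximation ratio in expectation, from a pointwise ratio `c` against every `q` that is
below the values of the unions of the greedy sets with the late part of an optimal set. -/
theorem le_expectedValue (hf : IsSubmodular f) (h0 : ∀ S, 0 ≤ f S) (hk : 2 ≤ k) (hε : 0 < ε)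
    (hε1 : ε ≤ 1) {c : ℝ} (hc : 0 ≤ c) (hc' : 0 ≤ 1 - 2 * ε - 6 / k)
    (hratio : ∀ (σ : Fin (Fintype.card E) ≃ E) (X O : Finset E),
      IsOutput f k ε (List.ofFn σ) X → O.card ≤ k →
      ((beaters f (windowSize (Fintype.card E) k ε) (3 * k) (List.ofFn σ)).card : ℝ)
        ≤ 18 * (k : ℝ) ^ 2 * Real.log k / ε →
      ∀ q, 0 ≤ q → (∀ j ≤ 3 * k, q ≤ f (greedySet f (windowSize (Fintype.card E) k ε)
        (List.ofFn σ) j ∪ tailPart k ε σ O)) → c * q ≤ f X)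
    {O : Finset E} (hO : O.card ≤ k) :
    c * (1 - 2 * ε - 6 / k) * f O ≤ (algorithm (Fintype.card E) k ε).expectedValue f := by
  obtain ⟨P, hP, hmax⟩ := Finset.exists_max_image
    (Finset.univ.filter fun Y : Finset E => Y.card ≤ k) f ⟨∅, by simp⟩
  have hPk : P.card ≤ k := by simpa using hP
  have hopt (Y : Finset E) (hY : Y.card ≤ k) : f Y ≤ f P := hmax Y (by simpa using hY)
  have h := le_sum_of_pointwise (n := Fintype.card E) hf h0 hk hε hε1 hc hPk hopt
    (fun σ => (algorithm (Fintype.card E) k ε).result f (List.ofFn σ))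
    fun σ => hratio σ _ P (isOutput_algorithm_ofFn f (by omega) hε hε1 σ) hPk
  have hN : (0 : ℝ) < Fintype.card (Fin (Fintype.card E) ≃ E) := by
    have : Nonempty (Fin (Fintype.card E) ≃ E) := ⟨(Fintype.equivFin E).symm⟩
    exact_mod_cast Fintype.card_pos
  refine (mul_le_mul_of_nonneg_left (hopt O hO) (mul_nonneg hc hc')).trans ?_
  rw [StreamingAlgorithm.expectedValue, Finset.expect_eq_sum_div_card, Finset.card_univ,
    le_div_iff₀ hN]
  exact h

end Expectation

end SymmetricStream

theorem mainTheorem2 :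
    ∃ A : ℕ → ℕ → ℝ → StreamingAlgorithm,
      -- `A n k ε` carries out SymmetricStream on every stream of `n` elements
      (∀ (n k : ℕ) (ε : ℝ), 1 ≤ k → 0 < ε → ε ≤ 1 →
        ∀ (E : Type u) [DecidableEq E] (f : Finset E → ℝ) (σ : Fin n ≃ E),
          SymmetricStream.IsOutput f k ε (List.ofFn σ) ((A n k ε).result f (List.ofFn σ))) ∧
      -- memory at all times, with one more slot for the element that arrives
      (∃ C : ℝ, ∀ (n k : ℕ) (ε : ℝ), 2 ≤ k → 0 < ε → ε ≤ 1 →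
        ∀ (E : Type u) [DecidableEq E] (f : Finset E → ℝ) (σ : Fin n ≃ E) (t : ℕ),
          (((A n k ε).memory f ((List.ofFn σ).take t)).slots.length : ℝ) + 1
              ≤ C * ((k : ℝ) ^ 2 * Real.log k / ε) ∧
          ((A n k ε).memory f ((List.ofFn σ).take t)).bits.length ≤ Nat.size n) ∧
      -- symmetric submodular functions
      (∃ ε₀ : ℝ, 0 < ε₀ ∧ ∃ k₀ : ℕ, ∀ (k : ℕ) (ε : ℝ), k₀ ≤ k → 0 < ε → ε ≤ ε₀ →
        ∀ (E : Type u) [Fintype E] [DecidableEq E] (f : Finset E → ℝ),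
          (∀ S, 0 ≤ f S) → IsSubmodular f → IsSymmetric f →
          ∀ O : Finset E, O.card ≤ k →
            0.5029 * f O ≤ (A (Fintype.card E) k ε).expectedValue f) ∧
      -- general submodular functions
      (∀ δ : ℝ, 0 < δ → ∃ ε₀ : ℝ, 0 < ε₀ ∧ ∃ k₀ : ℕ, ∀ (k : ℕ) (ε : ℝ),
        k₀ ≤ k → 0 < ε → ε ≤ ε₀ →
        ∀ (E : Type u) [Fintype E] [DecidableEq E] (f : Finset E → ℝ),
          (∀ S, 0 ≤ f S) → IsSubmodular f →
          ∀ O : Finset E, O.card ≤ k →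
            (1 / 2 - δ) * f O ≤ (A (Fintype.card E) k ε).expectedValue f) := by
  refine ⟨SymmetricStream.algorithm, ?_, ⟨23, ?_⟩, ?_, ?_⟩
  · intro n k ε hk hε hε1 E _ f σ
    exact SymmetricStream.isOutput_algorithm_ofFn f hk hε hε1 σ
  · intro n k ε hk hε hε1 E _ f σ t
    have hnd : (List.ofFn σ).Nodup := List.nodup_ofFn.2 σ.injective
    have ht : (List.ofFn σ).take t = (List.ofFn σ).take (min t (List.ofFn σ).length) := by
      rw [List.take_eq_take_iff]; simp
    have h1 := SymmetricStream.length_slots_le f hk hε hε1 hnd (min_le_right t _)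
    have h2 := SymmetricStream.length_bits_le f (by omega : 1 ≤ k) hε hε1 hnd (min_le_right t _)
    rw [← ht, List.length_ofFn] at h1 h2
    exact ⟨h1, h2⟩
  · -- `0.504 * (1 - 2 / 2000 - 6 / 6000) ≥ 0.5029`
    refine ⟨1 / 2000, by norm_num, 6000, fun k ε hk hε hε0 E _ _ f h0 hf hs O hO => ?_⟩
    have hk' : (6000 : ℝ) ≤ k := by exact_mod_cast hk
    have h6 : (6 : ℝ) / k ≤ 1 / 1000 := by
      rw [div_le_iff₀ (by linarith)]; linarith
    refine le_trans ?_ (SymmetricStream.le_expectedValue hf h0 (by omega) hε (by linarith)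
      (c := 0.504) (by norm_num) (by linarith)
      (fun σ X O hX hO hgood q hq0 hq =>
        SymmetricStream.le_output_of_isSymmetric hX hO hf h0 hgood hs hq0 hq) hO)
    refine mul_le_mul_of_nonneg_right ?_ (h0 O)
    linarith
  · intro δ hδ
    refine ⟨min (δ / 2) (1 / 4), by positivity, max 12 ⌈6 / δ⌉₊,
      fun k ε hk hε hε0 E _ _ f h0 hf O hO => ?_⟩
    have hk12 : 12 ≤ k := (le_max_left _ _).trans hk
    have hk' : (12 : ℝ) ≤ k := by exact_mod_cast hk12
    have hkδ : 6 / δ ≤ k := (Nat.le_ceil _).trans (by exact_mod_cast (le_max_right _ _).trans hk)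
    have h6 : (6 : ℝ) / k ≤ δ := by
      rw [div_le_iff₀ hδ] at hkδ
      rw [div_le_iff₀ (by linarith)]; linarith
    have h6' : (6 : ℝ) / k ≤ 1 / 2 := by
      rw [div_le_iff₀ (by linarith)]; linarith
    have hε1 : ε ≤ δ / 2 := hε0.trans (min_le_left _ _)
    have hε2 : ε ≤ 1 / 4 := hε0.trans (min_le_right _ _)
    refine le_trans ?_ (SymmetricStream.le_expectedValue hf h0 (by omega) hε (by linarith)
      (c := 1 / 2) (by norm_num) (by linarith)
      (fun σ X O hX hO hgood q _ hq =>
        SymmetricStream.half_le_output hX hO hf h0 hgood hq) hO)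
    refine mul_le_mul_of_nonneg_right ?_ (h0 O)
    linarith
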